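/- **Setting.** Let $G$ be a finite simple graph with vertex set $V$, with inputs $I\subseteq V$ and outputs $O\subseteq V$, and give each $v\notin O$ an angle $\theta_v\in\mathbb R$. Call $S\subseteq V$ *oddly connected* to $w$ if an odd number of edges join $w$ to $S$, and evenly connected otherwise. A *gflow* (for measurements in the $(X,Y)$ plane) consists of sets $g(v)\subseteq V\setminus I$ for $v\notin O$ and a time $t(v)\in\mathbb N$ for every $v \in V$ such that, for all $v\notin O$: (G1) $t(v)<t(w)$ for all $w\in g(v)$; (G2) if $t(w)\le t(v)$ and $w\neq v$ then $g(v)$ is evenly connected to $w$; (G3) $v\notin g(v)$ and $g(v)$ is oddly connected to $v$. Assume that a gflow is given. Let $\mathcal H_S=(\mathbb C^2)^{\otimes S}$, $|\pm_\theta\rangle=(|0\rangle\pm e^{i\theta}|1\rangle)/\sqrt2$, $X_v^{\theta}=\cos\theta\,X_v+\sin\theta\,Y_v$, $K_v=X_v\prod_{w\sim v}Z_w$, and $K_{g(v)}=\prod_{w\in g(v)}K_w$. Let $\mathcal E:\mathcal H_I\to\mathcal H_V$ be the encoding in the open graph state: adjoin $|+\rangle$ on the non-inputs and apply $CZ$ along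 all edges. *The measurement pattern.* After $\mathcal E$, the qubits $v\notin O$ are measured in the order of $t$, with outcomes $m_v\in\{0,1\}$, in the basis $|\pm_{\theta'_v}\rangle$ with adapted angle $\theta'_v=(-1)^{x_v}\theta_v+\pi z_v$, where $x_w=\sum_{u\notin O:\,w\in g(u)}m_u$ and $z_w=\sum_{u\notin O,\,u\ne w:\;g(u)\text{ oddly connected to }w}m_u$; finally $X_w^{x_w}Z_w^{z_w}$ is applied to each output $w$. Let $B_m:\mathcal H_I\to\mathcal H_O$ be the resulting unnormalised map for the outcomes $m$. *The adiabatic computation.* Let $d=\max_{v\notin O}(t(v)+1)$ (and $d=0$ if $O=V$). For $\gamma>0$, integers $k\ge0$ and real $s$ put $$H_k(s)=-\gamma\Big[\sum_{t(v)<k}X_v^{\theta_v}+\sum_{t(v)=k}\big((1-s)K_{g(v)}+sX_v^{\theta_v}\big)+\sum_{t(v)>k}K_{g(v)}\Big],$$ the sums running over $v\notin O$. The steps of the computation are $k=0,\dots,d-1$, in which $s$ runs from $0$ to $1$. **Theorem.** Each $\theta'_v$ depends only on the outcomes at non-output vertices $u$ with $t(u)<t(v)$, and there is an isometry $U:\mathcal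 H_I\to\mathcal H_O$ such that: 1. The pattern implements $U$ deterministically: for every $m$ there is $c_m\in\mathbb C$ with $|c_m|=1$ and $B_m=c_m\,2^{-|V\setminus O|/2}\,U$. 2. For every $\gamma>0$: * for $0\le k<d$ and $s\in[0,1]$, $H_k(s)$ is Hermitian, its ground space has dimension $2^{|O|}$, and every other eigenvalue is at least $\sqrt2\,\gamma$ above the ground energy. Moreover $H_k(1)=H_{k+1}(0)$ for all $k\ge0$, and the range of $\mathcal E$ lies in the ground space of $H_0(0)$; * the composition of the holonomies (parallel transports of the Wilczek–Zee connection in the ground spaces) along $H_0,\dots,H_{d-1}$ is defined on every $\mathcal E\varphi$ and maps it to $\bigotimes_{v\notin O}|+_{\theta_v}\rangle\otimes U\varphi$. So the holonomic computation performs the logical operation $U$ of the pattern; * the holonomic computation is the adiabatic limit of the dynamics: for every $\varepsilon>0$ there is $T>0$ such that for every $\tau\ge T$ there is a phase $c\in\mathbb C$, $|c|=1$, such that for every unit vector $\varphi\in\mathcal H_I$ the evolution from $\mathcal E\varphi$ under the Schrödinger equation ($\hbar=1$) with the Hamiltonians $H_k(t/\tau)$, $0\le t\le\tau$, for $k=0,\dots,d-1$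 in succession, exists, and its final state is within $\varepsilon$ in norm of $c\,\bigotimes_{v\notin O}|+_{\theta_v}\rangle\otimes U\varphi$. -/

import Mathlib

namespace AGQC

noncomputable section

/-- The Hilbert space of one qubit per element of `V`; the computational basis is indexed by
bit strings `V → Fin 2`. -/
abbrev Qubits (V : Type*) : Type _ := EuclideanSpace ℂ (V → Fin 2)

/-- Operators on the register `V`. -/
abbrev Op (V : Type*) : Type _ := Qubits V →L[ℂ] Qubits V

/-! ### Pauli operators, `CZ` gates -/

def pauliX : Matrix (Fin 2) (Fin 2) ℂ := !![0, 1; 1, 0]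
def pauliY : Matrix (Fin 2) (Fin 2) ℂ := !![0, -Complex.I; Complex.I, 0]
def pauliZ : Matrix (Fin 2) (Fin 2) ℂ := !![1, 0; 0, -1]

section Register

variable {V : Type*} [Fintype V] [DecidableEq V]

/-- The one-qubit operator `A` acting on qubit `v` (identity elsewhere):
`⟨x| A_v |ψ⟩ = ∑ b, A (x v) b * ψ (x with bit v replaced by b)`. -/
def siteOp (v : V) (A : Matrix (Fin 2) (Fin 2) ℂ) : Op V :=
  LinearMap.toContinuousLinearMap
    { toFun := fun ψ => WithLp.toLp 2 fun x => ∑ b, A (x v) b * ψ (Function.update x v b)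
      map_add' := fun ψ χ => by ext x; simp [mul_add, Finset.sum_add_distrib]
      map_smul' := fun c ψ => by ext x; simp [mul_add, mul_left_comm] }

theorem siteOp_apply (v : V) (A : Matrix (Fin 2) (Fin 2) ℂ) (ψ : Qubits V) (x : V → Fin 2) :
    siteOp v A ψ x = ∑ b, A (x v) b * ψ (Function.update x v b) := rfl

theorem siteOp_commute {u v : V} (h : u ≠ v) (A B : Matrix (Fin 2) (Fin 2) ℂ) :
    Commute (siteOp u A) (siteOp v B) := by
  refine ContinuousLinearMap.ext fun ψ => ?_
  ext x
  simp only [mul_apply_eq_comp, siteOp_apply,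
    Function.update_of_ne h.symm, Function.update_of_ne h,
    Function.update_comm h, Fin.sum_univ_two]
  ring

theorem siteOp_pairwise (S : Set V) (A : V → Matrix (Fin 2) (Fin 2) ℂ) :
    S.Pairwise (Function.onFun Commute fun w => siteOp w (A w)) :=
  fun _ _ _ _ h => siteOp_commute h _ _

/-- A diagonal operator in the computational basis. -/
def diagOp (f : (V → Fin 2) → ℂ) : Op V :=
  LinearMap.toContinuousLinearMap
    { toFun := fun ψ => WithLp.toLp 2 fun x => f x * ψ x
      map_add' := fun ψ χ => by ext x; simp [mul_add]
      map_smul' := fun c ψ => by ext x; simp [mul_left_comm] }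

theorem diagOp_apply (f : (V → Fin 2) → ℂ) (ψ : Qubits V) (x : V → Fin 2) :
    diagOp f ψ x = f x * ψ x := rfl

theorem diagOp_commute (f h : (V → Fin 2) → ℂ) : Commute (diagOp f) (diagOp h) := by
  refine ContinuousLinearMap.ext fun ψ => ?_
  ext x
  simp only [mul_apply_eq_comp, diagOp_apply]
  ring

open Classical in
/-- The `CZ` gate on the two end points of `e`. -/
def czGate (e : Sym2 V) : Op V := diagOp fun x => if ∀ v ∈ e, x v = 1 then -1 else 1

theorem czGate_pairwise (S : Set (Sym2 V)) :
    S.Pairwise (Function.onFun Commute czGate) :=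
  fun _ _ _ _ _ => diagOp_commute _ _

/-- The observable `X^θ = cos θ X + sin θ Y` on qubit `v`, whose eigenvectors are `|±_θ⟩`:
a measurement in the `(X,Y)` plane at angle `θ`. -/
def xyObs (v : V) (θ : ℝ) : Op V :=
  siteOp v ((Real.cos θ : ℂ) • pauliX + (Real.sin θ : ℂ) • pauliY)

/-! ### Graph states and their stabilisers -/

open Classical in
def nbhd (G : SimpleGraph V) (v : V) : Finset V := Finset.univ.filter fun w => G.Adj v w

open Classical in
def edges (G : SimpleGraph V) : Finset (Sym2 V) := Finset.univ.filter fun e => e ∈ G.edgeSet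

/-- The product of the `CZ` gates over all edges of `G`. -/
def entangle (G : SimpleGraph V) : Op V :=
  (edges G).noncommProd czGate (czGate_pairwise _)

/-- The stabiliser `K_v = X_v ∏_{w ∼ v} Z_w`. -/
def stab (G : SimpleGraph V) (v : V) : Op V :=
  siteOp v pauliX *
    (nbhd G v).noncommProd (fun w => siteOp w pauliZ) (siteOp_pairwise _ _)

theorem zProd_apply (S : Finset V) (ψ : Qubits V) (x : V → Fin 2) :
    S.noncommProd (fun w => siteOp w pauliZ) (siteOp_pairwise _ _) ψ x
      = (∏ w ∈ S, pauliZ (x w) (x w)) * ψ x := by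
  induction S using Finset.induction_on generalizing x with
  | empty => simp
  | insert a s ha ih =>
    rw [Finset.noncommProd_insert_of_notMem _ _ _ _ ha, mul_apply_eq_comp,
      siteOp_apply, Finset.prod_insert ha, mul_assoc, ← ih]
    have key : ∀ (i : Fin 2) (F : Fin 2 → ℂ),
        ∑ b, pauliZ i b * F b = pauliZ i i * F i := by
      intro i F
      fin_cases i <;> simp [pauliZ]
    rw [key]
    simp

theorem stab_apply (G : SimpleGraph V) (v : V) (ψ : Qubits V) (x : V → Fin 2) :
    stab G v ψ x =
      (∏ w ∈ nbhd G v, pauliZ (x w) (x w)) * ψ (Function.update x v (x v + 1)) := by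
  have hv : v ∉ nbhd G v := by simp [nbhd]
  have key : ∀ (i : Fin 2) (F : Fin 2 → ℂ), ∑ b, pauliX i b * F b = F (i + 1) := by
    intro i F
    fin_cases i <;> simp [pauliX]
  rw [stab, mul_apply_eq_comp, siteOp_apply, key, zProd_apply]
  congr 1
  refine Finset.prod_congr rfl fun w hw => ?_
  rw [Function.update_of_ne]
  rintro rfl
  exact hv hw

theorem stab_commute (G : SimpleGraph V) (u v : V) : Commute (stab G u) (stab G v) := by
  rcases eq_or_ne u v with rfl | h
  · exact Commute.refl _
  have sgn : ∀ (a b : V) (x : V → Fin 2), a ≠ b →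
      (∏ w ∈ nbhd G b, pauliZ (Function.update x a (x a + 1) w)
        (Function.update x a (x a + 1) w))
      = (if a ∈ nbhd G b then -1 else 1) * ∏ w ∈ nbhd G b, pauliZ (x w) (x w) := by
    intro a b x _
    have z : ∀ i : Fin 2, pauliZ (i + 1) (i + 1) = -1 * pauliZ i i := by
      intro i
      fin_cases i <;> simp [pauliZ]
    split_ifs with hm
    · rw [← Finset.mul_prod_erase _ _ hm, ← Finset.mul_prod_erase _ _ hm, Function.update_self, z,
        mul_assoc]
      congr 2
      refine Finset.prod_congr rfl fun w hw => ?_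
      rw [Function.update_of_ne (Finset.ne_of_mem_erase hw)]
    · rw [one_mul]
      refine Finset.prod_congr rfl fun w hw => ?_
      rw [Function.update_of_ne]
      rintro rfl
      exact hm hw
  have sym : (u ∈ nbhd G v) = (v ∈ nbhd G u) := by simp [nbhd, G.adj_comm]
  refine ContinuousLinearMap.ext fun ψ => ?_
  ext x
  simp only [mul_apply_eq_comp, stab_apply]
  rw [sgn u v x h, sgn v u x h.symm, Function.update_of_ne h.symm, Function.update_of_ne h,
    Function.update_comm h]
  simp only [sym]
  ring

theorem stab_pairwise (G : SimpleGraph V) (S : Set V) :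
    S.Pairwise (Function.onFun Commute (stab G)) :=
  fun _ _ _ _ _ => stab_commute G _ _

/-- `K_S = ∏_{w ∈ S} K_w`. -/
def stabProd (G : SimpleGraph V) (S : Finset V) : Op V :=
  S.noncommProd (stab G) (stab_pairwise G _)

/-- `S` is oddly connected to `w`: an odd number of edges joins `w` to `S`. -/
def OddlyConnected (G : SimpleGraph V) (S : Finset V) (w : V) : Prop :=
  Odd (S ∩ nbhd G w).card

/-- Put every qubit `v` outside `S` in the state `b v`, keeping the state `χ` of the qubits of `S`:
`χ ↦ χ ⊗ ⨂_{v ∉ S} b v`. -/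
def tensorWith (S : Finset V) (b : V → Fin 2 → ℂ) : Qubits S →L[ℂ] Qubits V :=
  LinearMap.toContinuousLinearMap
    { toFun := fun χ => WithLp.toLp 2 fun x => (∏ v ∈ Sᶜ, b v (x v)) * χ fun v : S => x v
      map_add' := fun ψ χ => by ext x; simp [mul_add]
      map_smul' := fun c ψ => by ext x; simp [mul_left_comm] }

end Register

/-- The vector `(|0⟩ + (-1)^m e^{iθ} |1⟩) / √2`, i.e. `|+_θ⟩` for `m = 0` and `|-_θ⟩` for `m = 1`. -/
def xyKet (θ : ℝ) (m : Fin 2) : Fin 2 → ℂ :=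
  ![(Real.sqrt 2 : ℂ)⁻¹, (-1) ^ (m : ℕ) * Complex.exp (θ * Complex.I) * (Real.sqrt 2 : ℂ)⁻¹]

/-! ### Measurement patterns and gflow -/

/-- The data of a measurement pattern with measurements in the `(X,Y)` plane: a graph with
inputs and outputs, a measurement angle for each vertex (only those of non-outputs matter), a
correction set `g v` for each `v` (only those of non-outputs matter), and the round `time v`
to which `v` belongs. -/
structure Pattern (V : Type*) where
  graph : SimpleGraph V
  input : Finset V
  output : Finset V
  angle : V → ℝ
  g : V → Finset V
  time : V → ℕ

namespace Pattern

variable {V : Type*} [Fintype V] [DecidableEq V] (p : Pattern V)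

/-- `(g, time)` is a gflow of the open graph (for measurements in the `(X,Y)` plane). -/
structure IsGflow : Prop where
  notMem_input : ∀ v ∉ p.output, ∀ w ∈ p.g v, w ∉ p.input
  future : ∀ v ∉ p.output, ∀ w ∈ p.g v, p.time v < p.time w
  even : ∀ v ∉ p.output, ∀ w, p.time w ≤ p.time v → w ≠ v →
    ¬ OddlyConnected p.graph (p.g v) w
  notMem_self : ∀ v ∉ p.output, v ∉ p.g v
  odd_self : ∀ v ∉ p.output, OddlyConnected p.graph (p.g v) v

/-- Non-inputs are prepared in `|+⟩`, then `CZ` gates are applied along all edges. -/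
def encode : Qubits p.input →L[ℂ] Qubits V :=
  entangle p.graph ∘L tensorWith p.input fun _ => xyKet 0 0

/-- The number of `X` corrections on `w` caused by the measurement outcomes `m`. -/
def xCount (m : V → Fin 2) (w : V) : ℕ :=
  ∑ u ∈ p.outputᶜ with w ∈ p.g u, (m u : ℕ)

open Classical in
/-- The number of `Z` corrections on `w` caused by the measurement outcomes `m`. -/
def zCount (m : V → Fin 2) (w : V) : ℕ :=
  ∑ u ∈ p.outputᶜ with u ≠ w ∧ OddlyConnected p.graph (p.g u) w, (m u : ℕ)

/-- The adapted measurement angle: `X` corrections flip its sign, `Z` corrections add `π`. -/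
def adaptedAngle (m : V → Fin 2) (v : V) : ℝ :=
  (-1) ^ p.xCount m v * p.angle v + p.zCount m v * Real.pi

/-- The Pauli corrections on the outputs. -/
def correction (m : V → Fin 2) : Op p.output :=
  Finset.univ.noncommProd
    (fun w : p.output => siteOp w (pauliX ^ p.xCount m w * pauliZ ^ p.zCount m w))
    (siteOp_pairwise _ fun w : p.output => pauliX ^ p.xCount m w * pauliZ ^ p.zCount m w)

/-- The (unnormalised) branch of the pattern with outcomes `m`: prepare the open graph state,
project each non-output qubit `v` on its measurement vector of outcome `m v` at the adapted angle
(discarding `v`), and correct the outputs. The squared norm of the result is the probability of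
this branch. -/
def branch (m : V → Fin 2) : Qubits p.input →L[ℂ] Qubits p.output :=
  p.correction m ∘L
    ContinuousLinearMap.adjoint
      (tensorWith p.output fun v => xyKet (p.adaptedAngle m v) (m v)) ∘L
    p.encode

/-- The pattern can be executed: each adapted angle depends on earlier outcomes only. -/
def IsCausal : Prop :=
  ∀ v ∉ p.output, ∀ m m' : V → Fin 2,
    (∀ u ∉ p.output, p.time u < p.time v → m u = m' u) →
      p.adaptedAngle m v = p.adaptedAngle m' v

/-- The pattern implements the isometry `U` deterministically: all outcomes are equally likely and
each leaves the outputs in the state `U φ`, up to a phase that does not depend on the input `φ`. -/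
def Implements (U : Qubits p.input →ₗᵢ[ℂ] Qubits p.output) : Prop :=
  ∀ m : V → Fin 2, ∃ c : ℂ, ‖c‖ = 1 ∧
    ∀ φ, p.branch m φ = (c * (Real.sqrt 2 : ℂ)⁻¹ ^ p.outputᶜ.card) • U φ

/-! ### The Hamiltonians -/

/-- The number of rounds. -/
def depth : ℕ := p.outputᶜ.sup fun v => p.time v + 1

/-- The Hamiltonian of step `k` at `s ∈ [0,1]`: on the vertices `v` of round `k`, `K_{g(v)}` is
replaced linearly by the observable measured on `v`; this has already happened for the earlier
rounds, and has still to happen for the later ones. -/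
def hamiltonian (γ : ℝ) (k : ℕ) (s : ℝ) : Op V :=
  (-γ : ℂ) • (∑ v ∈ p.outputᶜ with p.time v < k, xyObs v (p.angle v)
    + ∑ v ∈ p.outputᶜ with p.time v = k,
        (((1 - s : ℝ) : ℂ) • stabProd p.graph (p.g v) + (s : ℂ) • xyObs v (p.angle v))
    + ∑ v ∈ p.outputᶜ with k < p.time v, stabProd p.graph (p.g v))

/-- `|+_θ⟩` on every non-output (`θ` its angle), and `χ` on the outputs. -/
def readout : Qubits p.output →L[ℂ] Qubits V :=
  tensorWith p.output fun v => xyKet (p.angle v) 0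

end Pattern

/-! ### Ground spaces, holonomies, adiabatic evolution -/

section Dynamics

variable {V : Type*} [Fintype V] [DecidableEq V]

def IsEnergy (H : Op V) (E : ℝ) : Prop := Module.End.HasEigenvalue (H : Qubits V →ₗ[ℂ] Qubits V) (E : ℂ)

def groundEnergy (H : Op V) : ℝ := sInf {E : ℝ | IsEnergy H E}

def groundSpace (H : Op V) : Submodule ℂ (Qubits V) :=
  Module.End.eigenspace (H : Qubits V →ₗ[ℂ] Qubits V) (groundEnergy H : ℂ)

/-- `ψ` is transported along `H(s)`, `0 ≤ s ≤ 1`, by the Wilczek–Zee connection: it stays in the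
ground space and its velocity is orthogonal to the ground space. -/
def IsParallel (H : ℝ → Op V) (ψ : ℝ → Qubits V) : Prop :=
  ∀ s ∈ Set.Icc (0 : ℝ) 1, ψ s ∈ groundSpace (H s) ∧
    ∃ ψ' ∈ (groundSpace (H s))ᗮ, HasDerivWithinAt ψ ψ' (Set.Icc 0 1) s

/-- `ψ` solves the Schrödinger equation (`ħ = 1`) for the Hamiltonian `H(t/τ)`, `0 ≤ t ≤ τ`,
in the rescaled time `s = t/τ`. -/
def IsSchrodinger (H : ℝ → Op V) (τ : ℝ) (ψ : ℝ → Qubits V) : Prop :=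
  ∀ s ∈ Set.Icc (0 : ℝ) 1,
    HasDerivWithinAt ψ ((-(Complex.I * τ)) • H s (ψ s)) (Set.Icc 0 1) s

/-- The composition of the holonomies of the paths `H 0, …, H (d - 1)` takes `a` to `b`. -/
def HolonomyMaps (H : ℕ → ℝ → Op V) (d : ℕ) (a b : Qubits V) : Prop :=
  ∃ χ : ℕ → Qubits V, χ 0 = a ∧ χ d = b ∧
    ∀ k < d, ∃ ψ, IsParallel (H k) ψ ∧ ψ 0 = χ k ∧ ψ 1 = χ (k + 1)

/-- Driving a system by `H 0, …, H (d - 1)`, for a time `τ` each, takes `a` to `b`. -/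
def EvolutionMaps (H : ℕ → ℝ → Op V) (d : ℕ) (τ : ℝ) (a b : Qubits V) : Prop :=
  ∃ χ : ℕ → Qubits V, χ 0 = a ∧ χ d = b ∧
    ∀ k < d, ∃ ψ, IsSchrodinger (H k) τ ψ ∧ ψ 0 = χ k ∧ ψ 1 = χ (k + 1)

end Dynamics

end

end AGQC

/-! For each non-output `v`, write `A` for `K_{g(v)}` and `B` for the observable `X_v^{θ_v}`. Both
are self-adjoint involutions. By (G3) they anticommute. By (G1) and (G2), `K_{g(v)}` commutes with
the observable of every other vertex that is not later than `v`. Hence, in each step, the summands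
of the Hamiltonian commute, and each squares to a scalar `r²`, where `r = 1` or `r² = (1 - s)² +
s²`. The ground space is their joint eigenspace for the values `r`, and violating one summand costs
`2γr ≥ √2 γ` (`eigenvector_dichotomy`).

The operator `J = BA` satisfies `J² = -1` and `J* = -J`, so `cos β + sin β J` is unitary. It
conjugates `A` into `cos 2β A + sin 2β B`. With `2β` the polar angle of `(1 - s, s)`, the product of
these rotations over a round carries ground space to ground space. Its velocity lies in excited
eigenspaces, because `J` anticommutes with the moving summand, so the product is the parallel
transport (`exists_transport`, `IsGflow.isParallel`). As the transport is unitary and the last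
ground space is the range of the readout map, all ground spaces have dimension `2^|O|`.

At `β = π/4`, on states with `A = 1`, the rotation is `(1 + B)/√2`, which is `√2` times the
projection onto outcome 0. The total holonomy is thus the branch with all outcomes 0, renormalised
(`IsGflow.adjoint_readout_logical`), and this branch is therefore a multiple of an isometry `U`. For
other outcomes, the product of the `K_{g(u)}` with `m u = 1` fixes the encoded state. As a Pauli
operator it turns the adapted measurement vectors into the original ones and leaves exactly the
corrections on the outputs (`exists_phase_branch`).

For slow driving, the velocity of the transported state is an eigenvector with gap `2γr`. It
therefore has the form `(H - e) η` with explicit `η`, and adding `(i/τ) η` to the transported state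
solves the Schrödinger equation up to `O(1/τ)` (`adiabatic_estimate`). The dynamical phase depends
on the energy only, hence not on the input. -/

namespace AGQC

/-! ### Rotations generated by pairs of anticommuting involutions. -/

section Transport

variable {E : Type*} [NormedAddCommGroup E] [InnerProductSpace ℂ E]

theorem hasDerivWithinAt_opApply {F : Type*} [NormedAddCommGroup F] [NormedSpace ℂ F]
    {W : ℝ → E →L[ℂ] F} {W' : E →L[ℂ] F} {ψ : ℝ → E} {ψ' : E} {S : Set ℝ} {s : ℝ}
    (hW : HasDerivWithinAt W W' S s) (hψ : HasDerivWithinAt ψ ψ' S s) :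
    HasDerivWithinAt (fun s => W s (ψ s)) (W s ψ' + W' (ψ s)) S s :=
  (ContinuousLinearMap.restrictScalarsL ℂ E F ℝ ℝ).hasDerivWithinAt_of_bilinear (u := W) (v := ψ) hW hψ

/-- The rotation `cos β + sin β J` generated by an operator `J` with `J² = -1`. -/
noncomputable def rotation (J : E →L[ℂ] E) (β : ℝ) : E →L[ℂ] E :=
  (Real.cos β : ℂ) • 1 + (Real.sin β : ℂ) • J

/-- Since `J² = -1`, the rotation is `exp (β J)`. -/
theorem hasDerivAt_rotation {J : E →L[ℂ] E} (hJ : J * J = -1) (β : ℝ) :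
    HasDerivAt (rotation J) (J * rotation J β) β := by
  have hc : HasDerivAt (fun β : ℝ => (Real.cos β : ℂ)) ((-Real.sin β : ℝ) : ℂ) β :=
    (Real.hasDerivAt_cos β).ofReal_comp
  have hs : HasDerivAt (fun β : ℝ => (Real.sin β : ℂ)) ((Real.cos β : ℝ) : ℂ) β :=
    (Real.hasDerivAt_sin β).ofReal_comp
  refine ((hc.smul_const (1 : E →L[ℂ] E)).add (hs.smul_const J)).congr_deriv ?_
  rw [rotation, mul_add, mul_smul_comm, mul_smul_comm, hJ, mul_one]
  push_cast
  module

theorem rotation_mem_unitary [CompleteSpace E] {J : E →L[ℂ] E} (hJ : J * J = -1) (hs : star J = -J) (β : ℝ) :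
    rotation J β ∈ unitary (E →L[ℂ] E) := by
  have h : (Real.cos β : ℂ) * Real.cos β + (Real.sin β : ℂ) * Real.sin β = 1 := by
    have := Complex.cos_sq_add_sin_sq (β : ℂ)
    push_cast
    linear_combination this
  rw [Unitary.mem_iff]
  simp only [rotation, star_add, star_smul, star_one, hs, Complex.star_def, Complex.conj_ofReal,
    mul_add, add_mul, smul_mul_assoc, mul_smul_comm, one_mul, mul_one, neg_mul, mul_neg, hJ,
    smul_neg, neg_neg]
  constructor <;>
    refine Eq.trans (b := ((Real.cos β : ℂ) * Real.cos β + (Real.sin β : ℂ) * Real.sin β) •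
      (1 : E →L[ℂ] E)) (by module) (by rw [h, one_smul])

variable {A B : E →L[ℂ] E}

theorem mul_mul_self_of_anticommute (hA : A * A = 1) (hB : B * B = 1) (h : A * B = -(B * A)) :
    (B * A) * (B * A) = -1 := by
  calc (B * A) * (B * A) = B * (A * B) * A := by noncomm_ring
    _ = -((B * B) * (A * A)) := by rw [h]; noncomm_ring
    _ = -1 := by rw [hA, hB, one_mul]

theorem star_mul_of_anticommute [CompleteSpace E] (hA : IsSelfAdjoint A) (hB : IsSelfAdjoint B)
    (h : A * B = -(B * A)) : star (B * A) = -(B * A) := by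
  rw [star_mul, hA.star_eq, hB.star_eq, h]

/-- With `J = BA`, `A` anticommutes with `J`, so `exp (βJ) A exp (-βJ) = exp (2βJ) A`, and `J A =
B`. The angle doubles, as for a spin one half. -/
theorem intertwine_rotation (hA : A * A = 1) (hB : B * B = 1) (h : A * B = -(B * A)) (β : ℝ) :
    ((Real.cos (2 * β) : ℂ) • A + (Real.sin (2 * β) : ℂ) • B) * rotation (B * A) β
      = rotation (B * A) β * A := by
  have e1 : A * (B * A) = -B := by rw [← mul_assoc, h, neg_mul, mul_assoc, hA, mul_one]
  have e2 : B * (B * A) = A := by rw [← mul_assoc, hB, one_mul]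
  have e3 : B * A * A = B := by rw [mul_assoc, hA, mul_one]
  have h1 := Complex.cos_sq_add_sin_sq (β : ℂ)
  simp only [rotation, mul_add, add_mul, smul_mul_assoc, mul_smul_comm, one_mul, mul_one, e1, e2,
    e3, smul_neg]
  rw [Real.cos_two_mul, Real.sin_two_mul]
  push_cast
  have a1 : Complex.cos β * (2 * Complex.cos β ^ 2 - 1)
      + Complex.sin β * (2 * Complex.sin β * Complex.cos β) = Complex.cos β := by
    linear_combination 2 * Complex.cos β * h1
  have a2 : -(Complex.sin β * (2 * Complex.cos β ^ 2 - 1))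
      + Complex.cos β * (2 * Complex.sin β * Complex.cos β) = Complex.sin β := by ring
  have : ∀ c s a b : ℂ, c • (a • A + b • B) + s • (-(a • B) + b • A)
      = (c * a + s * b) • A + (-(s * a) + c * b) • B := by
    intros; module
  rw [this, a1, a2]

/-- The generator `BA` anticommutes with the whole plane spanned by `A` and `B`. It therefore flips
the sign of the interpolated term at every time, which makes the velocity of the transport an
excited vector. -/
theorem combination_mul_of_anticommute (h : A * B = -(B * A)) (a b : ℂ) :
    (a • A + b • B) * (B * A) = -((B * A) * (a • A + b • B)) := by
  have e1 : A * (B * A) = -((B * A) * A) := by rw [← mul_assoc, h, neg_mul]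
  have e2 : B * (B * A) = -((B * A) * B) := by rw [mul_assoc B A B, h, mul_neg, neg_neg]
  rw [add_mul, mul_add, smul_mul_assoc, smul_mul_assoc, mul_smul_comm, mul_smul_comm, e1, e2]
  module

theorem rotation_commute {D J : E →L[ℂ] E} (h : Commute D J) (β : ℝ) :
    Commute D (rotation J β) :=
  ((Commute.one_right D).smul_right _).add_right (h.smul_right _)

/-- Simultaneous rotation of the commuting involutions `A v`, `v ∈ S`, into the `B v`: the parallel
transport of their joint `+1` eigenspace. -/
theorem exists_transport [CompleteSpace E] {ι : Type*} [DecidableEq ι] (S : Finset ι) (A B : ι → E →L[ℂ] E)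
    (hA : ∀ v ∈ S, IsSelfAdjoint (A v)) (hB : ∀ v ∈ S, IsSelfAdjoint (B v))
    (hAA : ∀ v ∈ S, A v * A v = 1) (hBB : ∀ v ∈ S, B v * B v = 1)
    (hanti : ∀ v ∈ S, A v * B v = -(B v * A v))
    (cA : ∀ u ∈ S, ∀ v ∈ S, Commute (A u) (A v)) (cB : ∀ u ∈ S, ∀ v ∈ S, Commute (B u) (B v))
    (cAB : ∀ u ∈ S, ∀ v ∈ S, u ≠ v → Commute (A u) (B v)) :
    ∃ W : ℝ → E →L[ℂ] E, W 0 = 1 ∧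
      (∀ β, HasDerivAt W ((∑ v ∈ S, B v * A v) * W β) β) ∧
      (∀ β, W β ∈ unitary (E →L[ℂ] E)) ∧
      (∀ D, (∀ v ∈ S, Commute D (A v) ∧ Commute D (B v)) → ∀ β, Commute D (W β)) ∧
      (∀ v ∈ S, ∀ β, ((Real.cos (2 * β) : ℂ) • A v + (Real.sin (2 * β) : ℂ) • B v) * W β
        = W β * A v) ∧
      ∀ {F : Type*} [NormedAddCommGroup F] [NormedSpace ℂ F] (L : E →L[ℂ] F) (χ : E),
        (∀ v ∈ S, L ∘L B v = L) → (∀ v ∈ S, A v χ = χ) →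
          L (W (Real.pi / 4) χ) = (Real.sqrt 2 : ℂ) ^ S.card • L χ := by
  induction S using Finset.induction_on with
  | empty => exact ⟨fun _ => 1, rfl, fun β => by simpa using hasDerivAt_const β _,
      fun _ => one_mem _, fun D _ _ => Commute.one_right D, by simp, by intros; simp⟩
  | insert a S ha ih =>
    have mem : ∀ {v}, v ∈ S → v ∈ insert a S := Finset.mem_insert_of_mem
    have ma : a ∈ insert a S := Finset.mem_insert_self _ _
    have ne : ∀ {v}, v ∈ S → a ≠ v := fun hv h => ha (h ▸ hv)
    obtain ⟨W, W0, Wd, Wu, Wc, WA, WL⟩ := ih (fun v h => hA v (mem h)) (fun v h => hB v (mem h))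
      (fun v h => hAA v (mem h)) (fun v h => hBB v (mem h)) (fun v h => hanti v (mem h))
      (fun u h v h' => cA u (mem h) v (mem h')) (fun u h v h' => cB u (mem h) v (mem h'))
      (fun u h v h' => cAB u (mem h) v (mem h'))
    have hJ := mul_mul_self_of_anticommute (hAA a ma) (hBB a ma) (hanti a ma)
    have hJs := star_mul_of_anticommute (hA a ma) (hB a ma) (hanti a ma)
    have cAW : ∀ β, Commute (A a) (W β) :=
      Wc _ fun v h => ⟨cA a ma v (mem h), cAB a ma v (mem h) (ne h)⟩
    have cJ : ∀ v ∈ S, Commute (B a * A a) (A v) ∧ Commute (B a * A a) (B v) := fun v h =>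
      ⟨(cAB v (mem h) a ma (ne h).symm).symm.mul_left (cA a ma v (mem h)),
        (cB a ma v (mem h)).mul_left (cAB a ma v (mem h) (ne h))⟩
    -- The rotation of the new pair commutes with everything built from the other pairs, so the
    -- order of the factors is irrelevant.
    refine ⟨fun β => rotation (B a * A a) β * W β, by simp [rotation, W0], fun β => ?_,
      fun β => mul_mem (rotation_mem_unitary hJ hJs β) (Wu β), fun D hD β => ?_,
      fun v hv β => ?_, fun L χ hL hχ => ?_⟩
    · refine ((hasDerivAt_rotation hJ β).mul (Wd β)).congr_deriv ?_
      have : Commute (rotation (B a * A a) β) (∑ v ∈ S, B v * A v) :=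
        Commute.sum_right _ _ _ fun v hv =>
          (rotation_commute ((cJ v hv).2.symm.mul_left (cJ v hv).1.symm) β).symm
      rw [Finset.sum_insert ha, add_mul, mul_assoc, ← mul_assoc (rotation _ _), this.eq, mul_assoc,
        mul_assoc]
    · exact (rotation_commute ((hD a ma).2.mul_right (hD a ma).1) β).mul_right
        (Wc D (fun v h => hD v (mem h)) β)
    · rcases Finset.mem_insert.1 hv with rfl | hv
      · rw [← mul_assoc, intertwine_rotation (hAA v ma) (hBB v ma) (hanti v ma), mul_assoc,
          (cAW β).eq, mul_assoc]
      · have : Commute ((Real.cos (2 * β) : ℂ) • A v + (Real.sin (2 * β) : ℂ) • B v)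
            (rotation (B a * A a) β) :=
          rotation_commute (((cJ v hv).1.symm.smul_left _).add_left
            ((cJ v hv).2.symm.smul_left _)) β
        rw [← mul_assoc, this.eq, mul_assoc, WA v hv, mul_assoc]
    -- `L` absorbs `B a`, and `A a` passes through `W` to fix `χ`. The new rotation thus acts under
    -- `L` as `cos (π/4) + sin (π/4) = √2`.
    · have e1 : L (B a (A a (W (Real.pi / 4) χ))) = L (W (Real.pi / 4) χ) := by
        have h1 := DFunLike.congr_fun (cAW (Real.pi / 4)).eq χ
        simp only [mul_apply_eq_comp] at h1
        rw [h1, hχ a ma]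
        exact DFunLike.congr_fun (hL a ma) _
      have e2 : (rotation (B a * A a) (Real.pi / 4) * W (Real.pi / 4)) χ
          = (Real.sqrt 2 / 2 : ℂ) • W (Real.pi / 4) χ
            + (Real.sqrt 2 / 2 : ℂ) • B a (A a (W (Real.pi / 4) χ)) := by
        simp [rotation, Real.cos_pi_div_four, Real.sin_pi_div_four]
      have e3 := WL L χ (fun v h => hL v (mem h)) (fun v h => hχ v (mem h))
      rw [e2, map_add, map_smul, map_smul, e1, e3, Finset.card_insert_of_notMem ha, pow_succ,
        ← add_smul, smul_smul]
      congr 1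
      ring

end Transport

/-! ### Spectra of sums of commuting operators with scalar squares. -/

section Spectrum

variable {V : Type*} [Fintype V] [DecidableEq V] {ι : Type*}

theorem inner_self_eq_ofReal {E : Type*} [NormedAddCommGroup E] [InnerProductSpace ℂ E] (ψ : E) :
    inner ℂ ψ ψ = ((‖ψ‖ ^ 2 : ℝ) : ℂ) := by
  rw [inner_self_eq_norm_sq_to_K]
  push_cast
  rfl

theorem norm_apply_of_sq_eq {E : Type*} [NormedAddCommGroup E] [InnerProductSpace ℂ E]
    [CompleteSpace E] {C : E →L[ℂ] E} {r : ℝ} (hC : IsSelfAdjoint C) (hr : 0 ≤ r)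
    (h : C * C = ((r ^ 2 : ℝ) : ℂ) • 1) (ψ : E) : ‖C ψ‖ = r * ‖ψ‖ := by
  have h1 : inner ℂ (C ψ) (C ψ) = ((r ^ 2 : ℝ) : ℂ) * inner ℂ ψ ψ := by
    rw [← ContinuousLinearMap.adjoint_inner_right, ← ContinuousLinearMap.star_eq_adjoint,
      hC.star_eq, ← mul_apply_eq_comp, h]
    simp [inner_smul_right]
  rw [inner_self_eq_ofReal, inner_self_eq_ofReal] at h1
  have h2 : ‖C ψ‖ ^ 2 = (r * ‖ψ‖) ^ 2 := by
    rw [mul_pow]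
    exact_mod_cast h1
  exact (pow_left_inj₀ (norm_nonneg _) (by positivity) two_ne_zero).1 h2

/-- An eigenvector of `-γ ∑ v, C v`, where the `C v` are commuting self-adjoint operators with
squares `r v ^ 2`, either has all `C v = r v` or has an excited eigenvalue. -/
theorem eigenvector_dichotomy {E : Type*} [NormedAddCommGroup E] [InnerProductSpace ℂ E]
    [CompleteSpace E] (S : Finset ι) (C : ι → E →L[ℂ] E) (r : ι → ℝ)
    (hC : ∀ v ∈ S, IsSelfAdjoint (C v)) (hr : ∀ v ∈ S, 0 ≤ r v)
    (hsq : ∀ v ∈ S, C v * C v = ((r v ^ 2 : ℝ) : ℂ) • 1)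
    (cC : ∀ u ∈ S, ∀ v ∈ S, Commute (C u) (C v)) {γ e : ℝ} (hγ : 0 < γ) {ψ : E}
    (hψ : ((-γ : ℂ) • ∑ v ∈ S, C v) ψ = (e : ℂ) • ψ) :
    (∀ v ∈ S, C v ψ = (r v : ℂ) • ψ) ∨ ∃ v ∈ S, -γ * ∑ v ∈ S, r v + 2 * γ * r v ≤ e := by
  classical
  by_contra! hcon
  obtain ⟨⟨v, hv, hne⟩, hlt⟩ := hcon
  specialize hlt v hv
  -- As `(C v - r v)(C v + r v) = 0`, this vector lies in the `-r v` eigenspace of `C v`. It keeps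
  -- the energy `e`, because `C v` commutes with the sum.
  set χ := (C v - (r v : ℂ) • 1) ψ with hχ
  have hχ0 : χ ≠ 0 := by
    rw [hχ]
    simpa [sub_eq_zero] using hne
  have hcomm : Commute ((-γ : ℂ) • ∑ v ∈ S, C v) (C v - (r v : ℂ) • 1) := by
    refine Commute.smul_left (Commute.sub_right ?_ ?_) _
    · exact Commute.sum_left _ _ _ fun u hu => cC u hu v hv
    · exact (Commute.one_right _).smul_right _
  have hHχ : ((-γ : ℂ) • ∑ v ∈ S, C v) χ = (e : ℂ) • χ := by
    rw [hχ, ← mul_apply_eq_comp, hcomm.eq, mul_apply_eq_comp, hψ, map_smul]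
  have hCχ : C v χ = -(r v : ℂ) • χ := by
    have : C v * (C v - (r v : ℂ) • 1) = -(r v : ℂ) • (C v - (r v : ℂ) • 1) := by
      rw [mul_sub, hsq v hv, mul_smul_comm, mul_one]
      push_cast
      module
    rw [hχ, ← mul_apply_eq_comp, this]
    rfl
  have hpos : 0 < ‖χ‖ ^ 2 := by positivity
  have key : e * ‖χ‖ ^ 2 = -γ * ∑ u ∈ S, (inner ℂ χ (C u χ)).re := by
    have h1 : (inner ℂ χ ((e : ℂ) • χ)).re = e * ‖χ‖ ^ 2 := by
      rw [inner_smul_right, inner_self_eq_ofReal]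
      norm_cast
    rw [← h1, ← hHχ, smul_apply, inner_smul_right, sum_apply, inner_sum, ← Complex.re_sum,
      ← Complex.ofReal_neg, Complex.re_ofReal_mul]
  have hle : ∀ u ∈ S, (inner ℂ χ (C u χ)).re ≤ r u * ‖χ‖ ^ 2 := fun u hu => by
    calc (inner ℂ χ (C u χ)).re ≤ ‖χ‖ * ‖C u χ‖ := re_inner_le_norm (𝕜 := ℂ) χ (C u χ)
      _ = r u * ‖χ‖ ^ 2 := by rw [norm_apply_of_sq_eq (hC u hu) (hr u hu) (hsq u hu)]; ring
  have hvv : (inner ℂ χ (C v χ)).re = -r v * ‖χ‖ ^ 2 := by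
    rw [hCχ, inner_smul_right, inner_self_eq_ofReal]
    norm_cast
  -- Each term contributes at most `r u`, but the violated one contributes `-r v`, a loss of `2 * r
  -- v`.
  have hsum : ∑ u ∈ S, (inner ℂ χ (C u χ)).re ≤ (∑ u ∈ S, r u - 2 * r v) * ‖χ‖ ^ 2 := by
    rw [← Finset.add_sum_erase _ _ hv, ← Finset.add_sum_erase S r hv, hvv]
    have : ∑ u ∈ S.erase v, (inner ℂ χ (C u χ)).re ≤ ∑ u ∈ S.erase v, r u * ‖χ‖ ^ 2 :=
      Finset.sum_le_sum fun u hu => hle u (Finset.mem_of_mem_erase hu)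
    rw [← Finset.sum_mul] at this
    linarith
  have : e * ‖χ‖ ^ 2 ≥ -γ * ((∑ u ∈ S, r u - 2 * r v) * ‖χ‖ ^ 2) := by
    rw [key]
    nlinarith
  have h3 : e * ‖χ‖ ^ 2 < (-γ * ∑ u ∈ S, r u + 2 * γ * r v) * ‖χ‖ ^ 2 :=
    mul_lt_mul_of_pos_right hlt hpos
  linarith

/-- The joint eigenspace of the operators `C v`, `v ∈ S`, for the eigenvalues `r v`. -/
def jointSpace {E : Type*} [NormedAddCommGroup E] [InnerProductSpace ℂ E] (S : Finset ι)
    (C : ι → E →L[ℂ] E) (r : ι → ℝ) : Submodule ℂ E where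
  carrier := {ψ | ∀ v ∈ S, C v ψ = (r v : ℂ) • ψ}
  add_mem' := fun ha hb v hv => by rw [map_add, ha v hv, hb v hv, smul_add]
  zero_mem' := fun v _ => by simp
  smul_mem' := fun c a ha v hv => by rw [map_smul, ha v hv, smul_comm]

theorem mem_jointSpace {E : Type*} [NormedAddCommGroup E] [InnerProductSpace ℂ E] {S : Finset ι}
    {C : ι → E →L[ℂ] E} {r : ι → ℝ} {ψ : E} :
    ψ ∈ jointSpace S C r ↔ ∀ v ∈ S, C v ψ = (r v : ℂ) • ψ := Iff.rfl

theorem sum_apply_of_mem_jointSpace {E : Type*} [NormedAddCommGroup E] [InnerProductSpace ℂ E]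
    {S : Finset ι} {C : ι → E →L[ℂ] E} {r : ι → ℝ} {ψ : E} (hψ : ψ ∈ jointSpace S C r) (γ : ℝ) :
    ((-γ : ℂ) • ∑ v ∈ S, C v) ψ = ((-γ * ∑ v ∈ S, r v : ℝ) : ℂ) • ψ := by
  rw [smul_apply, sum_apply, Finset.sum_congr rfl hψ, ← Finset.sum_smul, smul_smul]
  push_cast
  rfl

variable (S : Finset ι) (C : ι → Op V) (r : ι → ℝ)
    (hC : ∀ v ∈ S, IsSelfAdjoint (C v)) (hr : ∀ v ∈ S, 0 < r v)
    (hsq : ∀ v ∈ S, C v * C v = ((r v ^ 2 : ℝ) : ℂ) • 1)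
    (cC : ∀ u ∈ S, ∀ v ∈ S, Commute (C u) (C v)) {γ : ℝ} (hγ : 0 < γ)
    (hne : jointSpace S C r ≠ ⊥)

include hC hr hsq cC hγ

theorem isEnergy_dichotomy {e : ℝ} (he : IsEnergy ((-γ : ℂ) • ∑ v ∈ S, C v) e) :
    e = -γ * ∑ v ∈ S, r v ∨ ∃ v ∈ S, -γ * ∑ v ∈ S, r v + 2 * γ * r v ≤ e := by
  obtain ⟨ψ, hψ⟩ := he.exists_hasEigenvector
  have h1 : ((-γ : ℂ) • ∑ v ∈ S, C v) ψ = (e : ℂ) • ψ := hψ.apply_eq_smul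
  refine (eigenvector_dichotomy S C r hC (fun v hv => (hr v hv).le) hsq cC hγ h1).imp_left
    fun h => ?_
  rw [sum_apply_of_mem_jointSpace h] at h1
  have := smul_left_injective ℂ hψ.2 h1
  exact_mod_cast this.symm

include hne

/-- The ground energy is defined as an infimum. A nonzero joint eigenvector attains it, and the
dichotomy shows that nothing lies below. -/
theorem groundEnergy_eq : groundEnergy ((-γ : ℂ) • ∑ v ∈ S, C v) = -γ * ∑ v ∈ S, r v := by
  obtain ⟨ψ, hψ, hψ0⟩ := Submodule.exists_mem_ne_zero_of_ne_bot hne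
  refine IsLeast.csInf_eq ⟨?_, fun e he => ?_⟩
  · exact Module.End.hasEigenvalue_of_hasEigenvector (x := ψ)
      ⟨Module.End.mem_eigenspace_iff.2 (sum_apply_of_mem_jointSpace hψ γ), hψ0⟩
  · rcases isEnergy_dichotomy S C r hC hr hsq cC hγ he with h | ⟨v, hv, h⟩
    · exact h.ge
    · have := mul_pos hγ (hr v hv)
      linarith

/-- The excited alternative of the dichotomy is impossible at the ground energy, since `2 * γ * r v
> 0`. -/
theorem groundSpace_eq : groundSpace ((-γ : ℂ) • ∑ v ∈ S, C v) = jointSpace S C r := by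
  ext ψ
  rw [groundSpace, groundEnergy_eq S C r hC hr hsq cC hγ hne, Module.End.mem_eigenspace_iff]
  refine ⟨fun h => ?_, fun h => sum_apply_of_mem_jointSpace h γ⟩
  rcases eigenvector_dichotomy S C r hC (fun v hv => (hr v hv).le) hsq cC hγ h with h | ⟨v, hv, h⟩
  · exact h
  · have := mul_pos hγ (hr v hv)
    linarith

end Spectrum

/-! ### Linear evolution equations, uniqueness of parallel transport, and the adiabatic estimate. -/

section Dynamics

open Set MeasureTheory

/-- The terms of the Dyson series of the linear equation `ψ' = K ψ`, `ψ 0 = x₀`. -/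
noncomputable def dysonTerm {E : Type*} [NormedAddCommGroup E] [NormedSpace ℝ E]
    (K : ℝ → E →L[ℝ] E) (x₀ : E) : ℕ → ℝ → E
  | 0 => fun _ => x₀
  | n + 1 => fun s => ∫ x in (0 : ℝ)..s, K x (dysonTerm K x₀ n x)

section Dyson

variable {E : Type*} [NormedAddCommGroup E] [NormedSpace ℝ E]
  {K : ℝ → E →L[ℝ] E} (hK : Continuous K) (x₀ : E)

include hK

theorem continuous_dysonTerm (n : ℕ) : Continuous (dysonTerm K x₀ n) := by
  induction n with
  | zero => exact continuous_const
  | succ n ih =>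
    exact intervalIntegral.continuous_primitive
      (fun a b => (hK.clm_apply ih).intervalIntegrable a b) 0

theorem hasDerivAt_dysonTerm_succ [CompleteSpace E] (n : ℕ) (s : ℝ) :
    HasDerivAt (dysonTerm K x₀ (n + 1)) (K s (dysonTerm K x₀ n s)) s := by
  have h := hK.clm_apply (continuous_dysonTerm hK x₀ n)
  exact intervalIntegral.integral_hasDerivAt_right (h.intervalIntegrable 0 s)
    h.aestronglyMeasurable.stronglyMeasurableAtFilter h.continuousAt

omit hK in
theorem norm_dysonTerm_le {M : ℝ} (hM : ∀ s, ‖K s‖ ≤ M) (n : ℕ) (s : ℝ) :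
    ‖dysonTerm K x₀ n s‖ ≤ (M * |s|) ^ n / n.factorial * ‖x₀‖ := by
  have hM0 : 0 ≤ M := (norm_nonneg _).trans (hM 0)
  induction n generalizing s with
  | zero => simp [dysonTerm]
  | succ n ih =>
    rw [dysonTerm, intervalIntegral.norm_intervalIntegral_eq]
    have h1 : ∀ x, ‖K x (dysonTerm K x₀ n x)‖ ≤ M ^ (n + 1) / n.factorial * ‖x₀‖ * |x - 0| ^ n := by
      intro x
      calc _ ≤ M * ((M * |x|) ^ n / n.factorial * ‖x₀‖) :=
            (K x).le_of_opNorm_le_of_le (hM x) (ih x)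
        _ = _ := by rw [sub_zero, mul_pow]; ring
    refine (norm_integral_le_of_norm_le ?_ (Filter.Eventually.of_forall h1)).trans ?_
    · exact (Continuous.integrableOn_uIoc (by fun_prop))
    · rw [integral_const_mul, integral_pow_abs_sub_uIoc, sub_zero, Nat.factorial_succ, mul_pow]
      push_cast
      apply le_of_eq
      field_simp

/-- Linear differential equations have global solutions. -/
theorem exists_hasDerivAt_linear_of_bounded [CompleteSpace E] {M : ℝ} (hM : ∀ s, ‖K s‖ ≤ M) :
    ∃ ψ : ℝ → E, ψ 0 = x₀ ∧ ∀ s ∈ Ioo (-2 : ℝ) 2, HasDerivAt ψ (K s (ψ s)) s := by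
  have hM0 : 0 ≤ M := (norm_nonneg _).trans (hM 0)
  have hsum : Summable fun n : ℕ => (M * 2) ^ n / n.factorial * ‖x₀‖ :=
    (Real.summable_pow_div_factorial _).mul_right _
  have hle : ∀ (n : ℕ), ∀ s ∈ Ioo (-2 : ℝ) 2,
      ‖dysonTerm K x₀ n s‖ ≤ (M * 2) ^ n / n.factorial * ‖x₀‖ := fun n s hs => by
    refine (norm_dysonTerm_le x₀ hM n s).trans ?_
    have : |s| ≤ 2 := abs_le.2 ⟨hs.1.le, hs.2.le⟩
    gcongr
  have h0 : (0 : ℝ) ∈ Ioo (-2 : ℝ) 2 := by norm_num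
  have hs : ∀ s ∈ Ioo (-2 : ℝ) 2, Summable fun n => dysonTerm K x₀ n s := fun s hs =>
    hsum.of_norm_bounded (fun n => hle n s hs)
  refine ⟨fun s => ∑' n, dysonTerm K x₀ n s, ?_, fun s hs' => ?_⟩
  · beta_reduce
    rw [tsum_eq_single 0]
    · rfl
    · intro n hn
      obtain ⟨n, rfl⟩ := Nat.exists_eq_succ_of_ne_zero hn
      simp [dysonTerm]
  -- Each term differentiates to `K` of the previous one, so the differentiated tail of the series
  -- is `K` applied to the whole series.
  · have h1 := hasDerivAt_tsum_of_isPreconnected (𝕜 := ℝ) (t := Ioo (-2 : ℝ) 2)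
      (g := fun n => dysonTerm K x₀ (n + 1)) (g' := fun n s => K s (dysonTerm K x₀ n s))
      (hsum.mul_left M) isOpen_Ioo isPreconnected_Ioo
      (fun n s _ => hasDerivAt_dysonTerm_succ hK x₀ n s)
      (fun n s hs => (K s).le_of_opNorm_le_of_le (hM s) (hle n s hs)) h0
      ((summable_nat_add_iff 1).2 (hs 0 h0)) hs'
    rw [ContinuousLinearMap.map_tsum _ (hs s hs')]
    refine (h1.const_add x₀).congr_of_eventuallyEq ?_
    filter_upwards [isOpen_Ioo.mem_nhds hs'] with x hx
    exact (hs x hx).tsum_eq_zero_add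

theorem exists_hasDerivWithinAt_linear [CompleteSpace E] :
    ∃ ψ : ℝ → E, ψ 0 = x₀ ∧
      ∀ s ∈ Icc (0 : ℝ) 1, HasDerivWithinAt ψ (K s (ψ s)) (Icc 0 1) s := by
  obtain ⟨M, hM⟩ := isCompact_Icc.exists_bound_of_continuousOn (s := Icc (0 : ℝ) 1) hK.continuousOn
  -- Clamping the time to `[0, 1]` makes the coefficient bounded on the whole line without changing
  -- it on `[0, 1]`.
  obtain ⟨ψ, h0, hψ⟩ := exists_hasDerivAt_linear_of_bounded
    (K := fun s => K (projIcc 0 1 zero_le_one s))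
    (hK.comp (continuous_subtype_val.comp (continuous_projIcc (h := zero_le_one)))) x₀
    (fun s => hM _ (projIcc 0 1 zero_le_one s).2)
  refine ⟨ψ, h0, fun s hs => ?_⟩
  have := (hψ s ⟨by linarith [hs.1], by linarith [hs.2]⟩).hasDerivWithinAt (s := Icc 0 1)
  rwa [projIcc_of_mem _ hs] at this

end Dyson

variable {E : Type*} [NormedAddCommGroup E] [InnerProductSpace ℂ E]

/-- The norm of a curve grows at most as fast as the component of its velocity along it. -/
theorem norm_le_of_re_inner_le {δ δ' : ℝ → E} {ε : ℝ}
    (hδ : ∀ s ∈ Icc (0 : ℝ) 1, HasDerivWithinAt δ (δ' s) (Icc 0 1) s)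
    (hε : ∀ s ∈ Icc (0 : ℝ) 1, |(inner ℂ (δ s) (δ' s)).re| ≤ ε * ‖δ s‖) (ε0 : 0 ≤ ε) :
    ‖δ 1‖ ≤ ‖δ 0‖ + ε := by
  -- The norm need not be differentiable where `δ` vanishes. It is replaced by `√(‖δ‖² + κ²)`, whose
  -- derivative is still at most `ε` in absolute value.
  refine le_of_forall_pos_le_add fun κ hκ => ?_
  have hpos : ∀ s, 0 < ‖δ s‖ ^ 2 + κ ^ 2 := fun s => by positivity
  have hd : ∀ s ∈ Icc (0 : ℝ) 1, HasDerivWithinAt (fun s => Real.sqrt (‖δ s‖ ^ 2 + κ ^ 2))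
      ((inner ℂ (δ s) (δ' s)).re / Real.sqrt (‖δ s‖ ^ 2 + κ ^ 2)) (Icc 0 1) s := fun s hs => by
    have h1 := ((hδ s hs).inner ℂ (hδ s hs))
    have h2 : HasDerivWithinAt (fun s => ‖δ s‖ ^ 2) (2 * (inner ℂ (δ s) (δ' s)).re)
        (Icc 0 1) s := by
      have h3 := Complex.reCLM.hasFDerivAt.comp_hasDerivWithinAt s h1
      refine (h3.congr_deriv ?_).congr_of_mem (fun x _ => ?_) hs
      · rw [Complex.reCLM_apply, Complex.add_re, ← inner_conj_symm (δ' s) (δ s), Complex.conj_re]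
        ring
      · rw [Function.comp_apply, Complex.reCLM_apply, inner_self_eq_ofReal, Complex.ofReal_re]
    refine ((h2.add_const (κ ^ 2)).sqrt (hpos s).ne').congr_deriv ?_
    field_simp
  have hb : ∀ s ∈ Icc (0 : ℝ) 1,
      ‖(inner ℂ (δ s) (δ' s)).re / Real.sqrt (‖δ s‖ ^ 2 + κ ^ 2)‖ ≤ ε := fun s hs => by
    have h4 : ‖δ s‖ ≤ Real.sqrt (‖δ s‖ ^ 2 + κ ^ 2) :=
      Real.le_sqrt_of_sq_le (by nlinarith [sq_nonneg κ])
    rw [norm_div, Real.norm_eq_abs, Real.norm_of_nonneg (Real.sqrt_nonneg _),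
      div_le_iff₀ (Real.sqrt_pos.2 (hpos s))]
    exact (hε s hs).trans (mul_le_mul_of_nonneg_left h4 ε0)
  have h := (convex_Icc (0 : ℝ) 1).norm_image_sub_le_of_norm_hasDerivWithin_le hd hb
    (left_mem_Icc.2 zero_le_one) (right_mem_Icc.2 zero_le_one)
  rw [sub_zero, norm_one, mul_one] at h
  have h5 : ‖δ 1‖ ≤ Real.sqrt (‖δ 1‖ ^ 2 + κ ^ 2) :=
    Real.le_sqrt_of_sq_le (by nlinarith [sq_nonneg κ])
  have h6 : Real.sqrt (‖δ 0‖ ^ 2 + κ ^ 2) ≤ ‖δ 0‖ + κ :=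
    Real.sqrt_le_iff.2 ⟨by positivity, by nlinarith [norm_nonneg (δ 0)]⟩
  linarith [(abs_le.1 h).2]

/-- A skew-adjoint generator does not change norms. This removes the term of size `τ` from the error
equation. -/
theorem re_inner_I_smul_of_isSelfAdjoint [CompleteSpace E] {H : E →L[ℂ] E} (hH : IsSelfAdjoint H)
    (τ : ℝ) (ψ : E) : (inner ℂ ψ ((-(Complex.I * τ)) • H ψ)).re = 0 := by
  have h1 : (inner ℂ ψ (H ψ)).im = 0 := by
    have : inner ℂ (H ψ) ψ = inner ℂ ψ (H ψ) := by
      rw [← ContinuousLinearMap.adjoint_inner_right, ← ContinuousLinearMap.star_eq_adjoint,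
        hH.star_eq]
    rw [← inner_conj_symm] at this
    exact Complex.conj_eq_iff_im.1 this
  rw [inner_smul_right]
  simp [h1]

theorem exists_hasDerivWithinAt_schrodinger [CompleteSpace E] {H : ℝ → E →L[ℂ] E}
    (hH : Continuous H) (τ : ℝ) (x₀ : E) :
    ∃ ψ : ℝ → E, ψ 0 = x₀ ∧
      ∀ s ∈ Icc (0 : ℝ) 1, HasDerivWithinAt ψ ((-(Complex.I * τ)) • H s (ψ s)) (Icc 0 1) s :=
  exists_hasDerivWithinAt_linear
    (K := fun s => ContinuousLinearMap.restrictScalarsL ℂ E E ℝ ℝ ((-(Complex.I * τ)) • H s))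
    ((ContinuousLinearMap.continuous _).comp (hH.const_smul (-(Complex.I * τ)))) x₀

/-- A quantitative adiabatic theorem: if `ω` moves in the eigenspaces of `H` with velocity
`(H - e) η`, then it is followed by the Schrödinger evolution up to a phase and an error `3M/τ`. -/
theorem adiabatic_estimate [CompleteSpace E] {H : ℝ → E →L[ℂ] E} {e F : ℝ → ℝ}
    {ψ ω η η' : ℝ → E} {M τ : ℝ}
    (hH : ∀ s ∈ Icc (0 : ℝ) 1, IsSelfAdjoint (H s))
    (hF : ∀ s ∈ Icc (0 : ℝ) 1, HasDerivWithinAt F (e s) (Icc 0 1) s)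
    (hω : ∀ s ∈ Icc (0 : ℝ) 1, HasDerivWithinAt ω (H s (η s) - (e s : ℂ) • η s) (Icc 0 1) s)
    (hHω : ∀ s ∈ Icc (0 : ℝ) 1, H s (ω s) = (e s : ℂ) • ω s)
    (hη : ∀ s ∈ Icc (0 : ℝ) 1, HasDerivWithinAt η (η' s) (Icc 0 1) s)
    (hM : ∀ s ∈ Icc (0 : ℝ) 1, ‖η s‖ ≤ M ∧ ‖η' s‖ ≤ M) (hτ : 0 < τ)
    (hψ : ∀ s ∈ Icc (0 : ℝ) 1, HasDerivWithinAt ψ ((-(Complex.I * τ)) • H s (ψ s)) (Icc 0 1) s)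
    {c : ℂ} (hc : ‖c‖ = 1) :
    ‖ψ 1 - (c * Complex.exp (-(Complex.I * τ) * (F 1 - F 0 : ℝ))) • ω 1‖
      ≤ ‖ψ 0 - c • ω 0‖ + 3 * M / τ := by
  set a : ℝ → ℂ := fun s => c * Complex.exp (-(Complex.I * τ) * (F s - F 0 : ℝ)) with ha
  have hna : ∀ s, ‖a s‖ = 1 := fun s => by
    rw [ha]
    simp only [norm_mul, hc, one_mul]
    rw [show -(Complex.I * τ) * ((F s - F 0 : ℝ) : ℂ) = ((-τ * (F s - F 0) : ℝ) : ℂ) * Complex.I by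
      push_cast; ring, Complex.norm_exp_ofReal_mul_I]
  have hτ' : (τ : ℂ) ≠ 0 := by exact_mod_cast hτ.ne'
  have da : ∀ s ∈ Icc (0 : ℝ) 1,
      HasDerivWithinAt a (a s * (-(Complex.I * τ) * e s)) (Icc 0 1) s := fun s hs => by
    have h1 := ((hF s hs).sub_const (F 0)).ofReal_comp.const_mul (-(Complex.I * τ))
    exact (h1.cexp.const_mul c).congr_deriv (by rw [ha]; ring)
  -- The correction `(I / τ) • η` is chosen so that `-iτ (H - e)` maps it to `(H - e) η`, the
  -- velocity of `ω`. Only its own derivative, of size `M / τ`, remains as a source.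
  have dY : ∀ s ∈ Icc (0 : ℝ) 1, HasDerivWithinAt (fun s => ψ s - a s • (ω s + (Complex.I / τ) • η s))
      ((-(Complex.I * τ)) • H s (ψ s - a s • (ω s + (Complex.I / τ) • η s))
        - (a s * (Complex.I / τ)) • η' s) (Icc 0 1) s := fun s hs => by
    have h1 := (hψ s hs).sub ((da s hs).smul ((hω s hs).add ((hη s hs).const_smul (Complex.I / τ))))
    refine h1.congr_deriv ?_
    simp only [Pi.add_apply, Pi.smul_apply, map_sub, map_smul, map_add, hHω s hs, smul_add, smul_sub, smul_smul]
    have e1 : -(Complex.I * τ) * (a s * (Complex.I / τ)) = a s := by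
      field_simp
      rw [Complex.I_sq]
      ring
    have e2 : a s * (-(Complex.I * τ) * e s) * (Complex.I / τ) = a s * e s := by
      linear_combination (e s : ℂ) * e1
    rw [e1, e2]
    module
  have hI : ‖Complex.I / (τ : ℂ)‖ = 1 / τ := by
    rw [norm_div, Complex.norm_I, Complex.norm_real, Real.norm_of_nonneg hτ.le]
  have hM0 : 0 ≤ M := (norm_nonneg _).trans (hM 0 (left_mem_Icc.2 zero_le_one)).1
  -- One `M / τ` comes from this source. The other two come from inserting the correction at `s = 0`
  -- and removing it at `s = 1`.
  have key := norm_le_of_re_inner_le (ε := M / τ) dY (fun s hs => ?_) (by positivity)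
  · have b : ∀ s ∈ Icc (0 : ℝ) 1, ‖a s • (Complex.I / (τ : ℂ)) • η s‖ ≤ M / τ := fun s hs => by
      rw [norm_smul, norm_smul, hna, hI, one_mul, one_div_mul_eq_div]
      gcongr
      exact (hM s hs).1
    have b0 := b 0 (left_mem_Icc.2 zero_le_one)
    have b1 := b 1 (right_mem_Icc.2 zero_le_one)
    have a0 : a 0 = c := by simp [ha]
    have h1 : ψ 1 - a 1 • ω 1 = ψ 1 - a 1 • (ω 1 + (Complex.I / τ) • η 1)
        + a 1 • (Complex.I / (τ : ℂ)) • η 1 := by module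
    have h0 : ψ 0 - a 0 • (ω 0 + (Complex.I / τ) • η 0) = ψ 0 - c • ω 0
        - a 0 • (Complex.I / (τ : ℂ)) • η 0 := by rw [← a0]; module
    calc ‖ψ 1 - a 1 • ω 1‖ ≤ ‖ψ 1 - a 1 • (ω 1 + (Complex.I / τ) • η 1)‖ + M / τ := by
          rw [h1]
          exact (norm_add_le _ _).trans (by gcongr)
      _ ≤ ‖ψ 0 - a 0 • (ω 0 + (Complex.I / τ) • η 0)‖ + M / τ + M / τ := by gcongr
      _ ≤ ‖ψ 0 - c • ω 0‖ + M / τ + M / τ + M / τ := by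
          rw [h0]
          gcongr
          exact (norm_sub_le _ _).trans (by gcongr)
      _ = _ := by ring
  · rw [inner_sub_right, Complex.sub_re, re_inner_I_smul_of_isSelfAdjoint (hH s hs), zero_sub,
      abs_neg]
    refine (Complex.abs_re_le_norm _).trans ((norm_inner_le_norm _ _).trans ?_)
    rw [norm_smul, norm_mul, hna, hI, one_mul, one_div_mul_eq_div, mul_comm]
    gcongr
    exact (hM s hs).2

section Register

variable {V : Type*} [Fintype V] [DecidableEq V]

/-- The difference of two parallel curves lies in the ground space while its velocity is orthogonal
to it, so its norm is constant. -/
theorem IsParallel.unique {H : ℝ → Op V} {ψ χ : ℝ → Qubits V} (hψ : IsParallel H ψ)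
    (hχ : IsParallel H χ) (h0 : ψ 0 = χ 0) : ψ 1 = χ 1 := by
  choose! hψm ψ' hψ' dψ using hψ
  choose! hχm χ' hχ' dχ using hχ
  have h := norm_le_of_re_inner_le (ε := 0) (δ := fun s => ψ s - χ s)
    (fun s hs => (dψ s hs).sub (dχ s hs)) (fun s hs => ?_) le_rfl
  · simp only [h0, sub_self, norm_zero, add_zero] at h
    exact sub_eq_zero.1 (norm_le_zero_iff.1 h)
  · rw [Submodule.inner_right_of_mem_orthogonal (Submodule.sub_mem _ (hψm s hs) (hχm s hs))
      (Submodule.sub_mem _ (hψ' s hs) (hχ' s hs))]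
    simp

theorem exists_isSchrodinger {H : ℝ → Op V} (hH : Continuous H) (τ : ℝ) (x₀ : Qubits V) :
    ∃ ψ, IsSchrodinger H τ ψ ∧ ψ 0 = x₀ := by
  obtain ⟨ψ, h0, h⟩ := exists_hasDerivWithinAt_schrodinger hH τ x₀
  exact ⟨ψ, h, h0⟩

end Register

end Dynamics

/-! ### Concrete formulas for qubit operators, stabilisers and open graph states. -/

section Register

variable {V : Type*} [Fintype V] [DecidableEq V]

/-! ### One-qubit operators -/

theorem siteOp_mul (v : V) (A B : Matrix (Fin 2) (Fin 2) ℂ) :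
    siteOp v A * siteOp v B = siteOp v (A * B) := by
  refine ContinuousLinearMap.ext fun ψ => ?_
  ext x
  simp only [mul_apply_eq_comp, siteOp_apply, Matrix.mul_apply, Function.update_self,
    Function.update_idem, Fin.sum_univ_two]
  ring

theorem siteOp_one (v : V) : siteOp v (1 : Matrix (Fin 2) (Fin 2) ℂ) = 1 := by
  refine ContinuousLinearMap.ext fun ψ => ?_
  ext x
  simp [siteOp_apply, Matrix.one_apply]

theorem star_siteOp (v : V) (A : Matrix (Fin 2) (Fin 2) ℂ) :
    star (siteOp v A) = siteOp v A.conjTranspose := by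
  rw [ContinuousLinearMap.star_eq_adjoint]
  refine ((ContinuousLinearMap.eq_adjoint_iff _ _).2 fun ψ χ => ?_).symm
  -- Exchanging the bit at `v` with the summation bit swaps row and column index of the matrix; this
  -- reindexing gives the transpose.
  have hinv : Function.Involutive fun q : (V → Fin 2) × Fin 2 =>
      (Function.update q.1 v q.2, q.1 v) := fun q => by simp
  simp only [PiLp.inner_apply, siteOp_apply, RCLike.inner_apply, map_sum, map_mul, Finset.mul_sum,
    Finset.sum_mul, Matrix.conjTranspose_apply, Complex.star_def, Complex.conj_conj]
  rw [← Fintype.sum_prod_type', ← Fintype.sum_prod_type',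
    ← Equiv.sum_comp (Function.Involutive.toPerm _ hinv)]
  refine Finset.sum_congr rfl fun q _ => ?_
  simp
  ring

/-- The bit string `x` with bit `v` flipped. -/
def flip (v : V) (x : V → Fin 2) : V → Fin 2 := Function.update x v (x v + 1)

omit [Fintype V] in
theorem flip_involutive (v : V) : Function.Involutive (flip v) := fun x => by
  have : ∀ i : Fin 2, i + 1 + 1 = i := by decide
  simp [flip, this]

/-- The diagonal of `pauliZ` serves as the sign character `i ↦ (-1)^i` of `Fin 2`. Signs are
computed with it from here on. -/
theorem pauliZ_add (i j : Fin 2) :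
    pauliZ (i + j) (i + j) = pauliZ i i * pauliZ j j := by
  fin_cases i <;> fin_cases j <;> simp [pauliZ]

theorem pauliZ_mul_self (i : Fin 2) : pauliZ i i * pauliZ i i = 1 := by
  fin_cases i <;> simp [pauliZ]

theorem conj_pauliZ (i : Fin 2) : (starRingEnd ℂ) (pauliZ i i) = pauliZ i i := by
  fin_cases i <;> simp [pauliZ]

theorem norm_pauliZ (i : Fin 2) : ‖pauliZ i i‖ = 1 := by
  fin_cases i <;> simp [pauliZ]

omit [Fintype V] in
theorem prod_pauliZ_flip (v : V) (S : Finset V) (x : V → Fin 2) :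
    ∏ w ∈ S, pauliZ (flip v x w) (flip v x w)
      = (if v ∈ S then -1 else 1) * ∏ w ∈ S, pauliZ (x w) (x w) := by
  have h : ∀ w, pauliZ (flip v x w) (flip v x w)
      = (if v = w then -1 else 1) * pauliZ (x w) (x w) := fun w => by
    by_cases hw : v = w
    · subst hw
      rw [flip, Function.update_self, pauliZ_add]
      simp [pauliZ]
    · rw [flip, Function.update_of_ne (Ne.symm hw), if_neg hw, one_mul]
  rw [Finset.prod_congr rfl fun w _ => h w, Finset.prod_mul_distrib, Finset.prod_ite_eq]

theorem xyObs_apply (v : V) (θ : ℝ) (ψ : Qubits V) (x : V → Fin 2) :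
    xyObs v θ ψ x = Complex.exp (-(pauliZ (x v) (x v) * (θ * Complex.I))) * ψ (flip v x) := by
  have key : ∀ (i : Fin 2) (F : Fin 2 → ℂ),
      ∑ b, ((Real.cos θ : ℂ) • pauliX + (Real.sin θ : ℂ) • pauliY) i b * F b
        = Complex.exp (-(pauliZ i i * (θ * Complex.I))) * F (i + 1) := by
    intro i F
    fin_cases i
    · simp [pauliX, pauliY, pauliZ, Complex.exp_mul_I, ← neg_mul]
    · simp [pauliX, pauliY, pauliZ, Complex.exp_mul_I]
  rw [xyObs, siteOp_apply, key]
  rfl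

theorem isSelfAdjoint_xyObs (v : V) (θ : ℝ) : IsSelfAdjoint (xyObs v θ) := by
  rw [isSelfAdjoint_iff, xyObs, star_siteOp]
  congr 1
  ext i j
  fin_cases i <;> fin_cases j <;>
    simp [pauliX, pauliY, ← Complex.cos_conj, ← Complex.sin_conj]

theorem xyObs_mul_self (v : V) (θ : ℝ) : xyObs v θ * xyObs v θ = 1 := by
  refine ContinuousLinearMap.ext fun ψ => ?_
  ext x
  rw [mul_apply_eq_comp, xyObs_apply, xyObs_apply, flip_involutive, ← mul_assoc, ← Complex.exp_add,
    flip, Function.update_self, pauliZ_add]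
  simp [pauliZ]

theorem xyObs_commute {u v : V} (θ : V → ℝ) : Commute (xyObs u (θ u)) (xyObs v (θ v)) := by
  rcases eq_or_ne u v with rfl | h
  · exact Commute.refl _
  · exact siteOp_commute h _ _

/-! ### Stabilisers -/

theorem stab_apply' (G : SimpleGraph V) (v : V) (ψ : Qubits V) (x : V → Fin 2) :
    stab G v ψ x = (∏ w ∈ nbhd G v, pauliZ (x w) (x w)) * ψ (flip v x) := stab_apply G v ψ x

omit [DecidableEq V] in
theorem notMem_nbhd_self (G : SimpleGraph V) (v : V) : v ∉ nbhd G v := by simp [nbhd]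

omit [DecidableEq V] in
theorem mem_nbhd_comm {G : SimpleGraph V} {v w : V} : v ∈ nbhd G w ↔ w ∈ nbhd G v := by
  simp [nbhd, G.adj_comm]

theorem stab_mul_self (G : SimpleGraph V) (v : V) : stab G v * stab G v = 1 := by
  refine ContinuousLinearMap.ext fun ψ => ?_
  ext x
  rw [mul_apply_eq_comp, stab_apply', stab_apply', flip_involutive, ← mul_assoc, prod_pauliZ_flip,
    if_neg (notMem_nbhd_self G v), one_mul, ← Finset.prod_mul_distrib]
  simp [pauliZ_mul_self]

theorem isSelfAdjoint_stab (G : SimpleGraph V) (v : V) : IsSelfAdjoint (stab G v) := by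
  rw [isSelfAdjoint_iff, ContinuousLinearMap.star_eq_adjoint]
  refine ((ContinuousLinearMap.eq_adjoint_iff _ _).2 fun ψ χ => ?_).symm
  simp only [PiLp.inner_apply, stab_apply', RCLike.inner_apply, map_mul, map_prod, conj_pauliZ]
  rw [← Equiv.sum_comp (flip_involutive v).toPerm]
  refine Finset.sum_congr rfl fun x _ => ?_
  rw [Function.Involutive.coe_toPerm, flip_involutive, prod_pauliZ_flip,
    if_neg (notMem_nbhd_self G v)]
  ring

/-- As `w ≠ v`, `K_w` acts on qubit `v` by `Z` if the two are adjacent and trivially otherwise, and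
`Z` anticommutes with every observable of the `(X,Y)` plane. -/
theorem stab_mul_xyObs (G : SimpleGraph V) {v w : V} (h : w ≠ v) (θ : ℝ) :
    stab G w * xyObs v θ = (if w ∈ nbhd G v then -1 else 1 : ℂ) • (xyObs v θ * stab G w) := by
  refine ContinuousLinearMap.ext fun ψ => ?_
  ext x
  have hc : flip v (flip w x) = flip w (flip v x) := by
    rw [flip, flip, flip, flip, Function.update_of_ne h.symm, Function.update_of_ne h,
      Function.update_comm h]
  rw [mul_apply_eq_comp, stab_apply', xyObs_apply, smul_apply, PiLp.smul_apply, mul_apply_eq_comp,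
    xyObs_apply, stab_apply', prod_pauliZ_flip, hc]
  have : flip w x v = x v := Function.update_of_ne h.symm _ _
  rw [this, smul_eq_mul, if_congr (mem_nbhd_comm (v := v)) rfl rfl]
  split_ifs <;> ring

theorem stabProd_empty (G : SimpleGraph V) : stabProd G ∅ = 1 := Finset.noncommProd_empty _ _

theorem stabProd_insert (G : SimpleGraph V) {a : V} {S : Finset V} (ha : a ∉ S) :
    stabProd G (insert a S) = stab G a * stabProd G S :=
  Finset.noncommProd_insert_of_notMem _ _ _ _ ha

theorem stab_commute_stabProd (G : SimpleGraph V) (a : V) (S : Finset V) :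
    Commute (stab G a) (stabProd G S) :=
  (Finset.noncommProd_commute _ _ _ _ fun _ _ => stab_commute G _ _)

theorem stabProd_commute (G : SimpleGraph V) (S T : Finset V) :
    Commute (stabProd G S) (stabProd G T) :=
  (Finset.noncommProd_commute _ _ _ _ fun _ _ => (stab_commute_stabProd G _ _).symm)

theorem isSelfAdjoint_stabProd (G : SimpleGraph V) (S : Finset V) :
    IsSelfAdjoint (stabProd G S) := by
  induction S using Finset.induction_on with
  | empty => rw [stabProd_empty]; exact .one _
  | insert a S ha ih =>
    rw [stabProd_insert G ha]
    exact ((isSelfAdjoint_stab G a).commute_iff ih).1 (stab_commute_stabProd G a S)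

theorem stabProd_mul_self (G : SimpleGraph V) (S : Finset V) : stabProd G S * stabProd G S = 1 := by
  induction S using Finset.induction_on with
  | empty => rw [stabProd_empty, one_mul]
  | insert a S ha ih =>
    rw [stabProd_insert G ha, mul_assoc, ← mul_assoc (stabProd G S), ← (stab_commute_stabProd G a S).eq,
      mul_assoc, ih, mul_one, stab_mul_self]

/-- One sign for each edge from `S` to `v`: odd connection means anticommuting, even connection
commuting. The hypothesis `v ∉ S` keeps `X_v` out of the product. -/
theorem stabProd_mul_xyObs (G : SimpleGraph V) {v : V} {S : Finset V} (h : v ∉ S) (θ : ℝ) :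
    stabProd G S * xyObs v θ
      = ((-1) ^ (S ∩ nbhd G v).card : ℂ) • (xyObs v θ * stabProd G S) := by
  induction S using Finset.induction_on with
  | empty => simp [stabProd_empty]
  | insert a S ha ih =>
    rw [Finset.mem_insert, not_or] at h
    rw [stabProd_insert G ha, mul_assoc, ih h.2, mul_smul_comm, ← mul_assoc,
      stab_mul_xyObs G (Ne.symm h.1), smul_mul_assoc, smul_smul, mul_assoc]
    congr 1
    by_cases hm : a ∈ nbhd G v
    · rw [if_pos hm, Finset.insert_inter_of_mem hm, Finset.card_insert_of_notMem, pow_succ]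
      exact fun h => ha (Finset.mem_inter.1 h).1
    · rw [if_neg hm, Finset.insert_inter_of_notMem hm, mul_one]

theorem stabProd_anticommute_xyObs (G : SimpleGraph V) {v : V} {S : Finset V} (h : v ∉ S)
    (ho : OddlyConnected G S v) (θ : ℝ) :
    stabProd G S * xyObs v θ = -(xyObs v θ * stabProd G S) := by
  rw [stabProd_mul_xyObs G h, Odd.neg_one_pow ho]
  module

theorem stabProd_commute_xyObs (G : SimpleGraph V) {v : V} {S : Finset V} (h : v ∉ S)
    (he : ¬ OddlyConnected G S v) (θ : ℝ) : Commute (stabProd G S) (xyObs v θ) := by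
  rw [Commute, SemiconjBy, stabProd_mul_xyObs G h, Even.neg_one_pow (Nat.not_odd_iff_even.1 he),
    one_smul]

/-! ### Open graph states -/

open Classical in
theorem entangle_apply (G : SimpleGraph V) (ψ : Qubits V) (x : V → Fin 2) :
    entangle G ψ x = (∏ e ∈ edges G, if ∀ v ∈ e, x v = 1 then (-1 : ℂ) else 1) * ψ x := by
  have h : ∀ S : Finset (Sym2 V), S.noncommProd czGate (czGate_pairwise _) ψ x
      = (∏ e ∈ S, if ∀ v ∈ e, x v = 1 then (-1 : ℂ) else 1) * ψ x := fun S => by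
    induction S using Finset.induction_on with
    | empty => simp
    | insert a S ha ih =>
      rw [Finset.noncommProd_insert_of_notMem _ _ _ _ ha, mul_apply_eq_comp, czGate, diagOp_apply,
        ih, Finset.prod_insert ha, mul_assoc]
  exact h _

open Classical in
-- Edges that avoid `v` do not notice the flip. The phase of an edge `vw` changes by `(-1)^(x w)`.
theorem prod_edges_flip (G : SimpleGraph V) (v : V) (x : V → Fin 2) :
    (∏ e ∈ edges G, if ∀ w ∈ e, flip v x w = 1 then (-1 : ℂ) else 1)
      = (∏ w ∈ nbhd G v, pauliZ (x w) (x w))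
        * ∏ e ∈ edges G, if ∀ w ∈ e, x w = 1 then (-1 : ℂ) else 1 := by
  rw [← Finset.prod_filter_mul_prod_filter_not (edges G) (fun e => v ∈ e),
    ← Finset.prod_filter_mul_prod_filter_not (edges G) (fun e => v ∈ e)
      (fun e => if ∀ w ∈ e, x w = 1 then (-1 : ℂ) else 1), ← mul_assoc]
  have himg : (edges G).filter (fun e => v ∈ e) = (nbhd G v).image fun w => s(v, w) := by
    ext e
    induction e with | _ a b => ?_
    simp only [edges, nbhd, Finset.mem_filter, Finset.mem_univ, true_and, SimpleGraph.mem_edgeSet,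
      Sym2.mem_iff, Finset.mem_image, Sym2.eq_iff]
    constructor
    · rintro ⟨h, rfl | rfl⟩
      · exact ⟨b, h, Or.inl ⟨rfl, rfl⟩⟩
      · exact ⟨a, h.symm, Or.inr ⟨rfl, rfl⟩⟩
    · rintro ⟨w, h, ⟨rfl, rfl⟩ | ⟨rfl, rfl⟩⟩
      · exact ⟨h, Or.inl rfl⟩
      · exact ⟨h.symm, Or.inr rfl⟩
  have hinj : Set.InjOn (fun w => s(v, w)) (nbhd G v : Set V) := fun a _ b _ h => by
    exact Sym2.congr_right.1 h
  congr 1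
  · rw [himg, Finset.prod_image hinj, Finset.prod_image hinj, ← Finset.prod_mul_distrib]
    refine Finset.prod_congr rfl fun w hw => ?_
    have hne : w ≠ v := fun h => notMem_nbhd_self G v (h ▸ hw)
    have h1 : flip v x v = x v + 1 := Function.update_self _ _ _
    have h2 : flip v x w = x w := Function.update_of_ne hne _ _
    simp only [Sym2.mem_iff, forall_eq_or_imp, forall_eq, h1, h2]
    generalize x v = i
    generalize x w = j
    fin_cases i <;> fin_cases j <;> simp [pauliZ]
  · refine Finset.prod_congr rfl fun e he => ?_
    have he' := (Finset.mem_filter.1 he).2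
    have : ∀ w ∈ e, flip v x w = x w := fun w hw =>
      Function.update_of_ne (fun h : w = v => he' (h ▸ hw)) _ _
    exact if_congr (forall₂_congr fun w hw => by rw [this w hw]) rfl rfl

theorem tensorWith_apply (S : Finset V) (b : V → Fin 2 → ℂ) (χ : Qubits S) (x : V → Fin 2) :
    tensorWith S b χ x = (∏ v ∈ Sᶜ, b v (x v)) * χ fun v : S => x v := rfl

/-- The phase that the `CZ` gates acquire when `v` is flipped is cancelled by the `Z` factors of
`K_v`. What remains is the invariance of `|+⟩` under `X`. -/
theorem stab_entangle_tensorWith (G : SimpleGraph V) {S : Finset V} {v : V} (hv : v ∉ S)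
    {b : V → Fin 2 → ℂ} (hb : ∀ i, b v (i + 1) = b v i) (χ : Qubits S) :
    stab G v (entangle G (tensorWith S b χ)) = entangle G (tensorWith S b χ) := by
  ext x
  rw [stab_apply', entangle_apply, entangle_apply, prod_edges_flip, ← mul_assoc, ← mul_assoc,
    ← Finset.prod_mul_distrib]
  simp only [pauliZ_mul_self, Finset.prod_const_one, one_mul]
  congr 1
  rw [tensorWith_apply, tensorWith_apply]
  congr 1
  · refine Finset.prod_congr rfl fun w _ => ?_
    by_cases h : w = v
    · subst h
      rw [flip, Function.update_self, hb]
    · rw [flip, Function.update_of_ne h]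
  · refine congrArg χ ?_
    funext w
    exact Function.update_of_ne (fun h : (w : V) = v => hv (h ▸ w.2)) _ _

theorem norm_entangle (G : SimpleGraph V) (ψ : Qubits V) : ‖entangle G ψ‖ = ‖ψ‖ := by
  classical
  rw [EuclideanSpace.norm_eq, EuclideanSpace.norm_eq]
  congr 1
  refine Finset.sum_congr rfl fun x _ => ?_
  rw [entangle_apply, norm_mul, norm_prod, Finset.prod_eq_one, one_mul]
  intro e _
  split_ifs <;> simp

theorem norm_tensorWith (S : Finset V) {b : V → Fin 2 → ℂ}
    (hb : ∀ v ∉ S, ∑ i, ‖b v i‖ ^ 2 = 1) (χ : Qubits S) : ‖tensorWith S b χ‖ = ‖χ‖ := by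
  rw [EuclideanSpace.norm_eq, EuclideanSpace.norm_eq]
  congr 1
  rw [← Equiv.sum_comp (Equiv.piEquivPiSubtypeProd (· ∈ S) fun _ : V => Fin 2).symm,
    Fintype.sum_prod_type]
  refine Finset.sum_congr rfl fun y _ => ?_
  have h : ∀ z : {v // v ∉ S} → Fin 2, ‖tensorWith S b χ
      ((Equiv.piEquivPiSubtypeProd (· ∈ S) fun _ : V => Fin 2).symm (y, z))‖ ^ 2
        = (∏ v : {v // v ∉ S}, ‖b v (z v)‖ ^ 2) * ‖χ y‖ ^ 2 := fun z => by
    rw [tensorWith_apply, norm_mul, mul_pow, norm_prod, ← Finset.prod_pow,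
      Finset.prod_subtype Sᶜ (p := (· ∉ S)) (by simp)]
    congr 1
    · refine Finset.prod_congr rfl fun v _ => ?_
      simp [Equiv.piEquivPiSubtypeProd, v.2]
    · refine congrArg (fun y => ‖χ y‖ ^ 2) ?_
      funext v
      simp [Equiv.piEquivPiSubtypeProd]
  rw [Finset.sum_congr rfl fun z _ => h z, ← Finset.sum_mul]
  have h1 := Finset.prod_univ_sum (fun _ => (Finset.univ : Finset (Fin 2))) fun (v : {v // v ∉ S}) i => ‖b v i‖ ^ 2
  rw [Fintype.piFinset_univ] at h1
  rw [← h1, Finset.prod_eq_one (fun (v : {v // v ∉ S}) _ => hb v.1 v.2), one_mul]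

theorem sum_norm_xyKet (θ : ℝ) (m : Fin 2) : ∑ i, ‖xyKet θ m i‖ ^ 2 = 1 := by
  simp [xyKet, Fin.sum_univ_two, Complex.norm_exp_ofReal_mul_I]
  norm_num

end Register

/-! ### Bookkeeping of Pauli operators up to phase. -/

section Pauli

variable {V : Type*} [Fintype V] [DecidableEq V]

theorem ofNat_add (a b : ℕ) : Fin.ofNat 2 (a + b) = Fin.ofNat 2 a + Fin.ofNat 2 b := by
  ext
  simp [Fin.val_add]

/-- `Q` is, up to a phase, the Pauli operator `∏ w, Z_w ^ b w X_w ^ a w`. -/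
def IsPauli (Q : Op V) (a b : V → ℕ) : Prop :=
  ∃ c : ℂ, ‖c‖ = 1 ∧ ∀ ψ x, Q ψ x =
    c * (∏ w, pauliZ (x w) (x w) ^ b w) * ψ fun w => x w + Fin.ofNat 2 (a w)

omit [DecidableEq V] in
theorem IsPauli.one : IsPauli (1 : Op V) 0 0 :=
  ⟨1, norm_one, fun ψ x => by simp⟩

omit [DecidableEq V] in
theorem IsPauli.mul {Q Q' : Op V} {a b a' b' : V → ℕ} (h : IsPauli Q a b) (h' : IsPauli Q' a' b') :
    IsPauli (Q * Q') (a + a') (b + b') := by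
  obtain ⟨c, hc, h⟩ := h
  obtain ⟨c', hc', h'⟩ := h'
  refine ⟨c * c' * ∏ w, pauliZ (Fin.ofNat 2 (a w)) (Fin.ofNat 2 (a w)) ^ b' w, ?_, fun ψ x => ?_⟩
  · rw [norm_mul, norm_mul, hc, hc', norm_prod, Finset.prod_eq_one]
    · norm_num
    · intro w _
      rw [norm_pow, norm_pauliZ, one_pow]
  · rw [mul_apply_eq_comp, h, h']
    simp only [pauliZ_add, mul_pow, Finset.prod_mul_distrib, Pi.add_apply, ofNat_add, pow_add,
      add_assoc]
    ring

theorem isPauli_stab (G : SimpleGraph V) (u : V) :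
    IsPauli (stab G u) (Pi.single u 1) (fun w => if w ∈ nbhd G u then 1 else 0) := by
  refine ⟨1, norm_one, fun ψ x => ?_⟩
  rw [stab_apply', one_mul]
  congr 1
  · simp [pow_ite, Finset.prod_ite_mem]
  · refine congrArg ψ ?_
    funext w
    by_cases h : w = u
    · subst h
      simp [flip]
    · simp [flip, h]

theorem isPauli_stabProd (G : SimpleGraph V) (S : Finset V) :
    IsPauli (stabProd G S) (fun w => if w ∈ S then 1 else 0) (fun w => (S ∩ nbhd G w).card) := by
  induction S using Finset.induction_on with
  | empty =>
    rw [stabProd_empty]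
    simp only [Finset.notMem_empty, if_false, Finset.empty_inter, Finset.card_empty]
    exact IsPauli.one
  | insert u S hu ih =>
    rw [stabProd_insert G hu]
    convert (isPauli_stab G u).mul ih using 1
    · funext w
      by_cases h : w = u
      · subst h
        simp [hu]
      · simp [h]
    · funext w
      rw [Pi.add_apply, if_congr mem_nbhd_comm rfl rfl]
      by_cases h : u ∈ nbhd G w
      · rw [if_pos h, Finset.insert_inter_of_mem h, Finset.card_insert_of_notMem, add_comm]
        exact fun h => hu (Finset.mem_inter.1 h).1
      · rw [if_neg h, Finset.insert_inter_of_notMem h, zero_add]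

theorem isPauli_siteOp (v : V) (a b : ℕ) :
    IsPauli (siteOp v (pauliX ^ a * pauliZ ^ b)) (Pi.single v a) (Pi.single v b) := by
  have hX : IsPauli (siteOp v pauliX) (Pi.single v 1) (Pi.single v 0) := by
    refine ⟨1, norm_one, fun ψ x => ?_⟩
    have key : ∀ (i : Fin 2) (F : Fin 2 → ℂ), ∑ b, pauliX i b * F b = F (i + 1) := by
      intro i F
      fin_cases i <;> simp [pauliX]
    rw [siteOp_apply, key]
    simp only [Pi.single_zero, Pi.zero_apply, pow_zero, Finset.prod_const_one, one_mul]
    refine congrArg ψ ?_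
    funext w
    by_cases h : w = v
    · subst h
      simp
    · simp [h]
  have hZ : IsPauli (siteOp v pauliZ) (Pi.single v 0) (Pi.single v 1) := by
    refine ⟨1, norm_one, fun ψ x => ?_⟩
    have key : ∀ (i : Fin 2) (F : Fin 2 → ℂ), ∑ b, pauliZ i b * F b = pauliZ i i * F i := by
      intro i F
      fin_cases i <;> simp [pauliZ]
    rw [siteOp_apply, key]
    simp [Pi.single_apply, pow_ite]
  have hpX : ∀ a : ℕ, IsPauli (siteOp v (pauliX ^ a)) (Pi.single v a) (Pi.single v 0) := by
    intro a
    induction a with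
    | zero => simpa [siteOp_one] using IsPauli.one (V := V)
    | succ n ih =>
      have := ih.mul hX
      rwa [siteOp_mul, ← pow_succ, ← Pi.single_add, ← Pi.single_add] at this
  have hpZ : ∀ b : ℕ, IsPauli (siteOp v (pauliZ ^ b)) (Pi.single v 0) (Pi.single v b) := by
    intro b
    induction b with
    | zero => simpa [siteOp_one] using IsPauli.one (V := V)
    | succ n ih =>
      have := ih.mul hZ
      rwa [siteOp_mul, ← pow_succ, ← Pi.single_add, ← Pi.single_add] at this
  have := (hpX a).mul (hpZ b)
  rwa [siteOp_mul, ← Pi.single_add, ← Pi.single_add, add_zero, zero_add] at this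

theorem isPauli_noncommProd (S : Finset V) (a b : V → ℕ) :
    IsPauli (S.noncommProd (fun w => siteOp w (pauliX ^ a w * pauliZ ^ b w))
      (siteOp_pairwise _ fun w => pauliX ^ a w * pauliZ ^ b w))
      (fun w => if w ∈ S then a w else 0) (fun w => if w ∈ S then b w else 0) := by
  induction S using Finset.induction_on with
  | empty =>
    rw [Finset.noncommProd_empty]
    simp only [Finset.notMem_empty, if_false]
    exact IsPauli.one
  | insert u S hu ih =>
    rw [Finset.noncommProd_insert_of_notMem _ _ _ _ hu]
    convert (isPauli_siteOp u (a u) (b u)).mul ih using 1 <;>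
    · funext w
      by_cases h : w = u
      · subst h
        simp [hu]
      · simp [h]

theorem pauliZ_pow_congr {i : Fin 2} {m n : ℕ} (h : m ≡ n [MOD 2]) :
    pauliZ i i ^ m = pauliZ i i ^ n := by
  have h2 : pauliZ i i ^ 2 = 1 := by rw [sq, pauliZ_mul_self]
  rw [← Nat.div_add_mod m 2, ← Nat.div_add_mod n 2, pow_add, pow_add, pow_mul, pow_mul, h2,
    one_pow, one_pow, h]

theorem siteOp_pauli_mem_unitary (v : V) (a b : ℕ) :
    siteOp v (pauliX ^ a * pauliZ ^ b) ∈ unitary (Op V) := by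
  have h : ∀ A : Matrix (Fin 2) (Fin 2) ℂ, A.conjTranspose = A → A * A = 1 → ∀ n : ℕ,
      siteOp v (A ^ n) ∈ unitary (Op V) := fun A h1 h2 n => by
    have h0 : siteOp v A ∈ unitary (Op V) := by
      rw [Unitary.mem_iff, star_siteOp, h1, siteOp_mul, h2, siteOp_one]
      exact ⟨rfl, rfl⟩
    induction n with
    | zero => rw [pow_zero, siteOp_one]; exact one_mem _
    | succ n ih => rw [pow_succ, ← siteOp_mul]; exact mul_mem ih h0
  rw [← siteOp_mul]
  refine mul_mem (h _ ?_ ?_ _) (h _ ?_ ?_ _) <;>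
  · ext i j
    fin_cases i <;> fin_cases j <;> simp [pauliX, pauliZ]

/-- An adapted measurement vector is, up to a phase, a Pauli image of the original one. -/
theorem exists_phase_xyKet (θ : ℝ) (a z : ℕ) (m : Fin 2) : ∃ κ : ℂ, ‖κ‖ = 1 ∧ ∀ i : Fin 2,
    pauliZ i i ^ (z + m) * xyKet ((-1) ^ a * θ + z * Real.pi) m (i + Fin.ofNat 2 a)
      = κ * xyKet θ 0 i := by
  have hexp : ∀ t : ℝ, Complex.exp (((t + z * Real.pi : ℝ) : ℂ) * Complex.I)
      = (-1) ^ z * Complex.exp (t * Complex.I) := fun t => by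
    push_cast
    rw [add_mul, Complex.exp_add, mul_assoc, Complex.exp_nat_mul, Complex.exp_pi_mul_I, mul_comm]
  have hs : ∀ n : ℕ, ((-1 : ℂ) ^ n) * (-1) ^ n = 1 := fun n => by
    rw [← mul_pow]; norm_num
  have hz := hs z
  have hm := hs m
  rcases Nat.even_or_odd a with ha | ha
  · refine ⟨1, norm_one, fun i => ?_⟩
    have h0 : Fin.ofNat 2 a = 0 := by
      ext; simpa using Nat.even_iff.1 ha
    rw [h0, add_zero, ha.neg_one_pow, one_mul, one_mul]
    fin_cases i
    · simp [xyKet, pauliZ]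
    · simp only [xyKet, pauliZ, hexp]
      simp [pow_add]
      linear_combination Complex.exp (θ * Complex.I) * (Real.sqrt 2 : ℂ)⁻¹ *
        ((-1 : ℂ) ^ z * (-1) ^ z * hm + hz)
  -- Flipping the bit sends `|0⟩ + e^{-iθ}|1⟩` to `e^{-iθ}(|0⟩ + e^{iθ}|1⟩)`, whence the phase.
  · refine ⟨(-1) ^ (z + (m : ℕ)) * Complex.exp ((-θ : ℝ) * Complex.I), ?_, fun i => ?_⟩
    · rw [norm_mul, Complex.norm_exp_ofReal_mul_I]
      simp
    have h0 : Fin.ofNat 2 a = 1 := by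
      ext; simpa using Nat.odd_iff.1 ha
    rw [h0, ha.neg_one_pow, neg_one_mul]
    fin_cases i
    · simp only [xyKet, pauliZ, hexp]
      simp [pow_add]
      ring
    · have : Complex.exp (-(θ * Complex.I)) * Complex.exp (θ * Complex.I) = 1 := by
        rw [← Complex.exp_add]; simp
      simp [xyKet, pauliZ, mul_assoc]
      rw [← mul_assoc (Complex.exp _), this, one_mul]

end Pauli

/-! ### Determinism of the pattern; encoding and readout maps. -/

namespace Pattern

variable {V : Type*} [Fintype V] [DecidableEq V] (p : Pattern V)

theorem correction_mem_unitary (m : V → Fin 2) : p.correction m ∈ unitary (Op p.output) :=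
  Submonoid.noncommProd_mem _ _ _ _ fun _ _ => siteOp_pauli_mem_unitary _ _ _

theorem isPauli_correction (m : V → Fin 2) :
    IsPauli (p.correction m) (fun w => p.xCount m w) (fun w => p.zCount m w) := by
  have h := isPauli_noncommProd Finset.univ (fun w : p.output => p.xCount m w)
    (fun w => p.zCount m w)
  simp only [Finset.mem_univ, if_true] at h
  exact h

variable {p}

/-- `Q` is the product of the `K_{g(u)}` over the `u ∈ T` with outcome 1. -/
theorem exists_unitary_isPauli (m : V → Fin 2) (T : Finset V) :
    ∃ Q ∈ unitary (Op V), (∀ ψ, (∀ u ∈ T, stabProd p.graph (p.g u) ψ = ψ) → Q ψ = ψ) ∧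
      IsPauli Q (fun w => ∑ u ∈ T, if w ∈ p.g u then (m u : ℕ) else 0)
        (fun w => ∑ u ∈ T, m u * (p.g u ∩ nbhd p.graph w).card) := by
  induction T using Finset.induction_on with
  | empty => exact ⟨1, one_mem _, fun _ _ => rfl, 
      by simp only [Finset.sum_empty]; exact IsPauli.one⟩
  | insert u T hu ih =>
    obtain ⟨Q, hQ, hQs, hQp⟩ := ih
    generalize hmu : m u = i
    fin_cases i
    · refine ⟨Q, hQ, fun ψ h => hQs ψ fun u hu => h u (Finset.mem_insert_of_mem hu), ?_⟩
      simpa [Finset.sum_insert hu, hmu] using hQp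
    · refine ⟨stabProd p.graph (p.g u) * Q, mul_mem ?_ hQ, fun ψ h => ?_, ?_⟩
      · rw [Unitary.mem_iff, (isSelfAdjoint_stabProd _ _).star_eq, stabProd_mul_self]
        exact ⟨rfl, rfl⟩
      · rw [mul_apply_eq_comp, hQs ψ fun u hu => h u (Finset.mem_insert_of_mem hu),
          h u (Finset.mem_insert_self _ _)]
      · convert (isPauli_stabProd p.graph (p.g u)).mul hQp using 1 <;>
        · funext w
          simp [Finset.sum_insert hu, hmu]

/-- `zCount` leaves out `u = w`. For a non-output `w` that term is odd by (G3), and the resulting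
extra `Z_w ^ m w` is what turns the outcome vector `m w` into the outcome vector 0. -/
theorem sum_card_modEq_zCount (hp : p.IsGflow) (m : V → Fin 2) (w : V) :
    ∑ u ∈ p.outputᶜ, m u * (p.g u ∩ nbhd p.graph w).card
      ≡ p.zCount m w + (if w ∈ p.output then 0 else (m w : ℕ)) [MOD 2] := by
  classical
  have h1 : ∀ u ∈ p.outputᶜ, m u * (p.g u ∩ nbhd p.graph w).card
      ≡ if OddlyConnected p.graph (p.g u) w then (m u : ℕ) else 0 [MOD 2] := fun u _ => by
    split_ifs with h
    · simpa using Nat.ModEq.mul_left (m u : ℕ) (show _ ≡ 1 [MOD 2] from Nat.odd_iff.1 h)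
    · simpa using Nat.ModEq.mul_left (m u : ℕ)
        (show _ ≡ 0 [MOD 2] from Nat.even_iff.1 (Nat.not_odd_iff_even.1 h))
  have h2 : ∑ u ∈ p.outputᶜ, (if OddlyConnected p.graph (p.g u) w then (m u : ℕ) else 0)
      = p.zCount m w + if w ∈ p.output then 0 else (m w : ℕ) := by
    rw [zCount, Finset.sum_filter]
    have h3 : (if w ∈ p.output then 0 else (m w : ℕ))
        = ∑ u ∈ p.outputᶜ, if u = w then (m u : ℕ) else 0 := by
      rw [Finset.sum_ite_eq']
      by_cases h : w ∈ p.output <;> simp [h]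
    rw [h3, ← Finset.sum_add_distrib]
    refine Finset.sum_congr rfl fun u hu => ?_
    by_cases h : u = w
    · subst h
      simp [hp.odd_self u (Finset.mem_compl.1 hu)]
    · simp [h]
  rw [← h2]
  rw [Nat.ModEq, Finset.sum_nat_mod, Finset.sum_congr rfl h1, ← Finset.sum_nat_mod]

/-- On states stabilised by all `K_{g(u)}`, the branches of the measurement agree up to a phase. -/
theorem exists_phase_branch (hp : p.IsGflow) (m : V → Fin 2) : ∃ c : ℂ, ‖c‖ = 1 ∧
    ∀ ψ, (∀ u ∉ p.output, stabProd p.graph (p.g u) ψ = ψ) →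
      p.correction m (ContinuousLinearMap.adjoint
        (tensorWith p.output fun v => xyKet (p.adaptedAngle m v) (m v)) ψ)
        = c • ContinuousLinearMap.adjoint p.readout ψ := by
  obtain ⟨Q, hQ, hQs, c₁, hc₁, hQp⟩ := exists_unitary_isPauli (p := p) m p.outputᶜ
  obtain ⟨c₂, hc₂, hC⟩ := p.isPauli_correction m
  choose κ hκ hket using fun v => exists_phase_xyKet (p.angle v) (p.xCount m v) (p.zCount m v) (m v)
  set T := tensorWith p.output fun v => xyKet (p.adaptedAngle m v) (m v) with hT
  have hxc : ∀ w, ∑ u ∈ p.outputᶜ, (if w ∈ p.g u then (m u : ℕ) else 0) = p.xCount m w := fun w => by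
    rw [xCount, Finset.sum_filter]
  set c := c₁ * c₂⁻¹ * ∏ v ∈ p.outputᶜ, κ v with hc
  have hc₂0 : c₂ ≠ 0 := fun h => by simp [h] at hc₂
  have hnc : ‖c‖ = 1 := by
    rw [hc, norm_mul, norm_mul, norm_inv, hc₁, hc₂, norm_prod, Finset.prod_eq_one fun v _ => hκ v]
    norm_num
  -- On the non-outputs `Q` undoes the adaptation of the measurement vectors; on the outputs it is
  -- the correction.
  have key : Q ∘L T = c • (p.readout ∘L p.correction m) := by
    refine ContinuousLinearMap.ext fun χ => ?_
    ext x
    have h1 : ∏ w, pauliZ (x w) (x w) ^ (∑ u ∈ p.outputᶜ, m u * (p.g u ∩ nbhd p.graph w).card : ℕ)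
        = (∏ v ∈ p.outputᶜ, pauliZ (x v) (x v) ^ (p.zCount m v + m v))
          * ∏ w : p.output, pauliZ (x w) (x w) ^ p.zCount m w := by
      rw [← Finset.prod_compl_mul_prod p.output, Finset.univ_eq_attach,
        ← Finset.prod_attach p.output]
      congr 1
      · refine Finset.prod_congr rfl fun v hv => pauliZ_pow_congr ?_
        have := sum_card_modEq_zCount hp m v
        rwa [if_neg (Finset.mem_compl.1 hv)] at this
      · refine Finset.prod_congr rfl fun v hv => pauliZ_pow_congr ?_
        have := sum_card_modEq_zCount hp m v
        rwa [if_pos v.2, add_zero] at this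
    have h2 : (∏ v ∈ p.outputᶜ, pauliZ (x v) (x v) ^ (p.zCount m v + m v))
        * ∏ v ∈ p.outputᶜ, xyKet (p.adaptedAngle m v) (m v) (x v + Fin.ofNat 2 (p.xCount m v))
        = (∏ v ∈ p.outputᶜ, κ v) * ∏ v ∈ p.outputᶜ, xyKet (p.angle v) 0 (x v) := by
      rw [← Finset.prod_mul_distrib, ← Finset.prod_mul_distrib]
      exact Finset.prod_congr rfl fun v _ => hket v (x v)
    simp only [ContinuousLinearMap.comp_apply, smul_apply, PiLp.smul_apply, hQp, hT, readout,
      tensorWith_apply, hC, hxc, h1, smul_eq_mul]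
    have h3 : c₂ * c₂⁻¹ = 1 := mul_inv_cancel₀ hc₂0
    set X := c₁ * (∏ w : p.output, pauliZ (x w) (x w) ^ p.zCount m w)
      * χ (fun w : p.output => x w + Fin.ofNat 2 (p.xCount m w)) with hX
    rw [hc]
    linear_combination X * h2 - X * ((∏ v ∈ p.outputᶜ, κ v)
      * ∏ v ∈ p.outputᶜ, xyKet (p.angle v) 0 (x v)) * h3
  refine ⟨(starRingEnd ℂ) c, by simpa using hnc, fun ψ hψ => ?_⟩
  have h1 : ContinuousLinearMap.adjoint Q ψ = ψ := by
    have h2 : Q ψ = ψ := hQs ψ fun u hu => hψ u (Finset.mem_compl.1 hu)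
    calc ContinuousLinearMap.adjoint Q ψ = (star Q * Q) ψ := by
          rw [mul_apply_eq_comp, h2, ContinuousLinearMap.star_eq_adjoint]
      _ = ψ := by rw [Unitary.star_mul_self_of_mem hQ]; rfl
  -- Taking adjoints and using `Q* ψ = ψ` removes `Q`; unitarity of the correction then moves it to
  -- the other side.
  have h2 := congrArg (fun A => ContinuousLinearMap.adjoint A ψ) key
  simp only [ContinuousLinearMap.adjoint_comp, ContinuousLinearMap.comp_apply, map_smulₛₗ, h1,
    smul_apply] at h2
  rw [h2, map_smul, ← ContinuousLinearMap.star_eq_adjoint (p.correction m), ← mul_apply_eq_comp,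
    Unitary.mul_star_self_of_mem (p.correction_mem_unitary m)]
  rfl

/-! ### Encoding and readout -/

theorem norm_readout (χ : Qubits p.output) : ‖p.readout χ‖ = ‖χ‖ :=
  norm_tensorWith _ (fun _ _ => sum_norm_xyKet _ _) χ

theorem norm_encode (φ : Qubits p.input) : ‖p.encode φ‖ = ‖φ‖ := by
  rw [encode, ContinuousLinearMap.comp_apply, norm_entangle,
    norm_tensorWith _ (fun _ _ => sum_norm_xyKet _ _)]

theorem stabProd_encode {S : Finset V} (hS : ∀ w ∈ S, w ∉ p.input) (φ : Qubits p.input) :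
    stabProd p.graph S (p.encode φ) = p.encode φ := by
  induction S using Finset.induction_on with
  | empty => rw [stabProd_empty]; rfl
  | insert a S ha ih =>
    rw [stabProd_insert _ ha, mul_apply_eq_comp, ih fun w hw => hS w (Finset.mem_insert_of_mem hw)]
    refine stab_entangle_tensorWith _ (hS a (Finset.mem_insert_self _ _)) (fun i => ?_) φ
    fin_cases i <;> simp [xyKet]

theorem xyObs_readout {v : V} (hv : v ∉ p.output) (χ : Qubits p.output) :
    xyObs v (p.angle v) (p.readout χ) = p.readout χ := by
  ext x
  rw [xyObs_apply, readout, tensorWith_apply, tensorWith_apply, ← mul_assoc]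
  have hv' : v ∈ p.outputᶜ := Finset.mem_compl.2 hv
  congr 1
  · rw [← Finset.mul_prod_erase _ _ hv', ← Finset.mul_prod_erase _ _ hv', ← mul_assoc]
    congr 1
    · rw [flip, Function.update_self]
      generalize x v = i
      fin_cases i
      · simp [xyKet, pauliZ, ← mul_assoc, ← Complex.exp_add]
      · simp [xyKet, pauliZ]
    · refine Finset.prod_congr rfl fun w hw => ?_
      rw [flip, Function.update_of_ne (Finset.ne_of_mem_erase hw)]
  · refine congrArg χ ?_
    funext w
    exact Function.update_of_ne (fun h : (w : V) = v => hv (h ▸ w.2)) _ _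

theorem adjoint_readout_readout (χ : Qubits p.output) :
    ContinuousLinearMap.adjoint p.readout (p.readout χ) = χ := by
  have := (ContinuousLinearMap.norm_map_iff_adjoint_comp_self p.readout).1 norm_readout
  exact DFunLike.congr_fun this χ

/-- A state fixed by the observables of all non-outputs is a product state. -/
theorem exists_readout_eq {ψ : Qubits V}
    (hψ : ∀ v ∉ p.output, xyObs v (p.angle v) ψ = ψ) : ∃ χ, p.readout χ = ψ := by
  -- `√2` times the ket has entries `1` and `e^{iθ}`: the amplitude at bit 1 is `e^{iθ}` times that
  -- at bit 0.
  have h1 : ∀ v ∉ p.output, ∀ x, ψ x = Real.sqrt 2 * xyKet (p.angle v) 0 (x v)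
      * ψ (Function.update x v 0) := fun v hv x => by
    have hs : (Real.sqrt 2 : ℂ) ≠ 0 := by simp
    rcases (show x v = 0 ∨ x v = 1 by generalize x v = i; fin_cases i <;> simp) with h | h
    · rw [h, ← h, Function.update_eq_self, h]
      simp [xyKet, hs]
    · conv_lhs => rw [← hψ v hv]
      rw [xyObs_apply, flip, h]
      simp [xyKet, pauliZ]
      field_simp
      simp
  have h2 : ∀ T ⊆ p.outputᶜ, ∀ x, ψ x = (∏ v ∈ T, Real.sqrt 2 * xyKet (p.angle v) 0 (x v))
      * ψ fun w => if w ∈ T then 0 else x w := fun T => by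
    induction T using Finset.induction_on with
    | empty => intro _ x; simp
    | insert a T ha ih =>
      intro hT x
      rw [Finset.prod_insert ha, h1 a (Finset.mem_compl.1 (hT (Finset.mem_insert_self _ _))) x,
        ih (fun v hv => hT (Finset.mem_insert_of_mem hv)), mul_assoc, ← mul_assoc, ← mul_assoc]
      congr 1
      · congr 1
        refine Finset.prod_congr rfl fun v hv => ?_
        rw [Function.update_of_ne]
        rintro rfl
        exact ha hv
      · refine congrArg ψ ?_
        funext w
        by_cases hw : w = a
        · subst hw
          simp
        · simp [hw]
  refine ⟨WithLp.toLp 2 fun y => Real.sqrt 2 ^ p.outputᶜ.card *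
    ψ fun w => if h : w ∈ p.output then y ⟨w, h⟩ else 0, ?_⟩
  ext x
  rw [readout, tensorWith_apply, h2 _ subset_rfl x, Finset.prod_mul_distrib, Finset.prod_const]
  have : (fun w => if w ∈ p.outputᶜ then (0 : Fin 2) else x w)
      = fun w => if w ∈ p.output then x w else 0 := by
    funext w
    by_cases h : w ∈ p.output <;> simp [h]
  rw [this]
  simp
  ring

end Pattern

/-! ### Polar coordinates of the segment from `(1, 0)` to `(0, 1)`. -/

section Interpolation

/-- The norm of the vector `(1 - s, s)`. -/
noncomputable def radius (s : ℝ) : ℝ := Real.sqrt ((1 - s) ^ 2 + s ^ 2)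

theorem radius_sq_pos (s : ℝ) : 0 < (1 - s) ^ 2 + s ^ 2 := by nlinarith [sq_nonneg (1 - 2 * s)]

theorem radius_pos (s : ℝ) : 0 < radius s := Real.sqrt_pos.2 (radius_sq_pos s)

theorem radius_sq (s : ℝ) : radius s ^ 2 = (1 - s) ^ 2 + s ^ 2 := Real.sq_sqrt (radius_sq_pos s).le

theorem radius_zero : radius 0 = 1 := by simp [radius]

theorem radius_one : radius 1 = 1 := by simp [radius]

/-- The radius is smallest at `s = 1/2`, where it is `1/√2`; this is the source of the constant in
the gap. -/
theorem sqrt_two_le_radius (s : ℝ) : Real.sqrt 2 ≤ 2 * radius s := by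
  refine Real.sqrt_le_iff.2 ⟨by have := radius_pos s; positivity, ?_⟩
  rw [mul_pow, radius_sq]
  nlinarith [sq_nonneg (1 - 2 * s)]

theorem contDiff_radius {n : WithTop ℕ∞} : ContDiff ℝ n radius :=
  ContDiff.sqrt (by fun_prop) fun s => (radius_sq_pos s).ne'

/-- Half the polar angle of the vector `(1 - s, s)`. -/
noncomputable def halfAngle (s : ℝ) : ℝ := (Real.arctan (2 * s - 1) + Real.pi / 4) / 2

theorem halfAngle_zero : halfAngle 0 = 0 := by simp [halfAngle]

theorem halfAngle_one : halfAngle 1 = Real.pi / 4 := by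
  norm_num [halfAngle]

theorem hasDerivAt_halfAngle (s : ℝ) : HasDerivAt halfAngle (1 / (2 * radius s ^ 2)) s := by
  have h1 : HasDerivAt (fun s : ℝ => 2 * s - 1) 2 s := by
    simpa using ((hasDerivAt_id s).const_mul 2).sub_const 1
  refine ((h1.arctan.add_const (Real.pi / 4)).div_const 2).congr_deriv ?_
  have h2 := radius_sq_pos s
  have h3 : 1 + (2 * s - 1) ^ 2 = 2 * radius s ^ 2 := by rw [radius_sq]; ring
  rw [h3]
  have := (radius_pos s).ne'
  field_simp

theorem sqrt_one_add_sq (s : ℝ) : Real.sqrt (1 + (2 * s - 1) ^ 2) = Real.sqrt 2 * radius s := by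
  rw [radius, ← Real.sqrt_mul zero_le_two]
  congr 1
  ring

theorem radius_mul_cos (s : ℝ) : radius s * Real.cos (2 * halfAngle s) = 1 - s := by
  have h := (radius_pos s).ne'
  have h2 : Real.sqrt 2 ≠ 0 := by positivity
  rw [halfAngle, mul_div_cancel₀ _ two_ne_zero, Real.cos_add, Real.cos_arctan, Real.sin_arctan,
    Real.cos_pi_div_four, Real.sin_pi_div_four, sqrt_one_add_sq]
  field_simp
  ring

theorem radius_mul_sin (s : ℝ) : radius s * Real.sin (2 * halfAngle s) = s := by
  have h := (radius_pos s).ne'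
  have h2 : Real.sqrt 2 ≠ 0 := by positivity
  rw [halfAngle, mul_div_cancel₀ _ two_ne_zero, Real.sin_add, Real.cos_arctan, Real.sin_arctan,
    Real.cos_pi_div_four, Real.sin_pi_div_four, sqrt_one_add_sq]
  field_simp
  ring

end Interpolation

/-! ### Transport along the linear interpolation. -/

section Transport

open Set

variable {E : Type*} [NormedAddCommGroup E] [InnerProductSpace ℂ E] [CompleteSpace E]

theorem isSelfAdjoint_ofReal_smul {A : E →L[ℂ] E} (hA : IsSelfAdjoint A) (r : ℝ) :
    IsSelfAdjoint ((r : ℂ) • A) :=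
  IsSelfAdjoint.smul (show IsSelfAdjoint (r : ℂ) from Complex.conj_ofReal r) hA

theorem isSelfAdjoint_neg_smul_sum {ι : Type*} (γ : ℝ) (S : Finset ι) {A : ι → E →L[ℂ] E}
    (hA : ∀ v, IsSelfAdjoint (A v)) : IsSelfAdjoint ((-γ : ℂ) • ∑ v ∈ S, A v) := by
  rw [← Complex.ofReal_neg]
  exact isSelfAdjoint_ofReal_smul (isSelfAdjoint_sum _ fun v _ => hA v) _

/-- The parallel transport along the linear interpolation from the commuting involutions `A v` to
the `B v`. -/
theorem exists_transport_interpolation {ι : Type*} [DecidableEq ι] (S : Finset ι)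
    (A B : ι → E →L[ℂ] E)
    (hA : ∀ v ∈ S, IsSelfAdjoint (A v)) (hB : ∀ v ∈ S, IsSelfAdjoint (B v))
    (hAA : ∀ v ∈ S, A v * A v = 1) (hBB : ∀ v ∈ S, B v * B v = 1)
    (hanti : ∀ v ∈ S, A v * B v = -(B v * A v))
    (cA : ∀ u ∈ S, ∀ v ∈ S, Commute (A u) (A v)) (cB : ∀ u ∈ S, ∀ v ∈ S, Commute (B u) (B v))
    (cAB : ∀ u ∈ S, ∀ v ∈ S, u ≠ v → Commute (A u) (B v)) :
    ∃ W : ℝ → E →L[ℂ] E, W 0 = 1 ∧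
      (∀ χ s, HasDerivAt (fun s => W s χ)
        (((1 / (2 * radius s ^ 2) : ℝ) : ℂ) • (∑ v ∈ S, B v * A v) (W s χ)) s) ∧
      (∀ q : ℝ → ℝ, ContDiff ℝ 1 q → ∃ M : ℝ, ∀ χ, ∃ η' : ℝ → E, ∀ s ∈ Icc (0 : ℝ) 1,
        HasDerivWithinAt (fun s => (q s : ℂ) • (∑ v ∈ S, B v * A v) (W s χ)) (η' s) (Icc 0 1) s ∧
        ‖(q s : ℂ) • (∑ v ∈ S, B v * A v) (W s χ)‖ ≤ M * ‖χ‖ ∧ ‖η' s‖ ≤ M * ‖χ‖) ∧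
      (∀ s, W s ∈ unitary (E →L[ℂ] E)) ∧
      (∀ D, (∀ v ∈ S, Commute D (A v) ∧ Commute D (B v)) → ∀ s, Commute D (W s)) ∧
      (∀ v ∈ S, ∀ s, (((1 - s : ℝ) : ℂ) • A v + (s : ℂ) • B v) * W s
        = (radius s : ℂ) • (W s * A v)) ∧
      ∀ {F : Type*} [NormedAddCommGroup F] [NormedSpace ℂ F] (L : E →L[ℂ] F) (χ : E),
        (∀ v ∈ S, L ∘L B v = L) → (∀ v ∈ S, A v χ = χ) →
          L (W 1 χ) = (Real.sqrt 2 : ℂ) ^ S.card • L χ := by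
  obtain ⟨W, W0, Wd, Wu, Wc, WA, WL⟩ := exists_transport S A B hA hB hAA hBB hanti cA cB cAB
  set J := ∑ v ∈ S, B v * A v with hJ
  have hd : ∀ s, HasDerivAt (fun s => W (halfAngle s))
      (((1 / (2 * radius s ^ 2) : ℝ) : ℂ) • (J * W (halfAngle s))) s := fun s =>
    ((Wd (halfAngle s)).scomp s (hasDerivAt_halfAngle s)).congr_deriv
      (Complex.coe_smul _ _).symm
  have hcont : Continuous fun s => W (halfAngle s) :=
    continuous_iff_continuousAt.2 fun s => (hd s).continuousAt
  have hrc : Continuous fun s => ((1 / (2 * radius s ^ 2) : ℝ) : ℂ) :=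
    Complex.continuous_ofReal.comp (continuous_const.div
      (continuous_const.mul ((contDiff_radius (n := 0)).continuous.pow 2))
      fun s => by have := radius_pos s; positivity)
  have hC : ContDiff ℝ 1 fun s => W (halfAngle s) := by
    refine contDiff_one_iff_deriv.2 ⟨fun s => (hd s).differentiableAt, ?_⟩
    rw [funext fun s => (hd s).deriv]
    exact hrc.smul (continuous_const.mul hcont)
  refine ⟨fun s => W (halfAngle s), by simpa only [halfAngle_zero] using W0, fun χ s => ?_,
    fun q hq => ?_, fun s => Wu _, fun D hD s => Wc D hD _, fun v hv s => ?_, fun L χ hL hχ => ?_⟩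
  · have := hasDerivWithinAt_opApply (hd s).hasDerivWithinAt (hasDerivWithinAt_const s univ χ)
    rw [hasDerivWithinAt_univ] at this
    exact this.congr_deriv (by rw [map_zero, zero_add]; rfl)
  -- The bounds are taken on the operator-valued curve, so that `M` is the same for all `χ`.
  · have hN : ContDiff ℝ 1 fun s => (q s : ℂ) • (J * W (halfAngle s)) :=
      (Complex.ofRealCLM.contDiff.comp hq).smul (contDiff_const.mul hC)
    obtain ⟨M₁, hM₁⟩ := isCompact_Icc.exists_bound_of_continuousOn (s := Icc (0 : ℝ) 1)
      hN.continuous.continuousOn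
    obtain ⟨M₂, hM₂⟩ := isCompact_Icc.exists_bound_of_continuousOn (s := Icc (0 : ℝ) 1)
      (contDiff_one_iff_deriv.1 hN).2.continuousOn
    refine ⟨max M₁ M₂, fun χ => ⟨fun s => deriv (fun s => (q s : ℂ) • (J * W (halfAngle s))) s χ,
      fun s hs => ⟨?_, ?_, ?_⟩⟩⟩
    · have := hasDerivWithinAt_opApply (S := Icc 0 1)
        ((contDiff_one_iff_deriv.1 hN).1 s).hasDerivAt.hasDerivWithinAt
        (hasDerivWithinAt_const s (Icc 0 1) χ)
      exact this.congr_deriv (by rw [map_zero, zero_add])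
    · exact ContinuousLinearMap.le_of_opNorm_le ((q s : ℂ) • (J * W (halfAngle s)))
        ((hM₁ s hs).trans (le_max_left _ _)) χ
    · exact ContinuousLinearMap.le_of_opNorm_le _ ((hM₂ s hs).trans (le_max_right _ _)) χ
  · rw [← WA v hv, ← smul_mul_assoc, smul_add, smul_smul, smul_smul, ← Complex.ofReal_mul,
      ← Complex.ofReal_mul, radius_mul_cos, radius_mul_sin]
  · simpa only [halfAngle_one] using WL L χ hL hχ

end Transport

/-! ### Commutation relations from the gflow, and transport for one round. -/

namespace Pattern

open Set

variable {V : Type*} [Fintype V] [DecidableEq V] {p : Pattern V}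

theorem IsGflow.isCausal (hp : p.IsGflow) : p.IsCausal := by
  classical
  intro v hv m m' h
  have hx : p.xCount m v = p.xCount m' v := Finset.sum_congr rfl fun u hu => by
    obtain ⟨hu, hvu⟩ := Finset.mem_filter.1 hu
    rw [h u (Finset.mem_compl.1 hu) (hp.future u (Finset.mem_compl.1 hu) v hvu)]
  have hz : p.zCount m v = p.zCount m' v := Finset.sum_congr rfl fun u hu => by
    obtain ⟨hu, hne, ho⟩ := Finset.mem_filter.1 hu
    rw [h u (Finset.mem_compl.1 hu)]
    by_contra! hlt
    exact hp.even u (Finset.mem_compl.1 hu) v hlt hne.symm ho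
  rw [adaptedAngle, adaptedAngle, hx, hz]

variable (p)

/-- The term of the Hamiltonian (up to the factor `-γ`) that belongs to the vertex `v`. -/
noncomputable def term (k : ℕ) (s : ℝ) (v : V) : Op V :=
  if p.time v < k then xyObs v (p.angle v)
  else if p.time v = k then
    ((1 - s : ℝ) : ℂ) • stabProd p.graph (p.g v) + (s : ℂ) • xyObs v (p.angle v)
  else stabProd p.graph (p.g v)

/-- The positive eigenvalue of `term`. -/
noncomputable def termRadius (k : ℕ) (s : ℝ) (v : V) : ℝ := if p.time v = k then radius s else 1

theorem hamiltonian_eq (γ : ℝ) (k : ℕ) (s : ℝ) :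
    p.hamiltonian γ k s = (-γ : ℂ) • ∑ v ∈ p.outputᶜ, p.term k s v := by
  rw [hamiltonian, Finset.sum_filter, Finset.sum_filter, Finset.sum_filter,
    ← Finset.sum_add_distrib, ← Finset.sum_add_distrib]
  congr 1
  refine Finset.sum_congr rfl fun v _ => ?_
  rw [term]
  rcases lt_trichotomy (p.time v) k with h | h | h
  · simp [h, h.ne, h.not_gt]
  · simp [h]
  · simp [h, h.ne', h.not_gt]

omit [Fintype V] [DecidableEq V] in
theorem termRadius_pos (k : ℕ) (s : ℝ) (v : V) : 0 < p.termRadius k s v := by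
  rw [termRadius]
  split_ifs
  · exact radius_pos s
  · exact one_pos

omit [Fintype V] [DecidableEq V] in
theorem sqrt_two_le_termRadius (k : ℕ) (s : ℝ) (v : V) :
    Real.sqrt 2 ≤ 2 * p.termRadius k s v := by
  rw [termRadius]
  split_ifs
  · exact sqrt_two_le_radius s
  · exact Real.sqrt_le_iff.2 (by norm_num)

omit [Fintype V] [DecidableEq V] in
theorem termRadius_zero (k : ℕ) (v : V) : p.termRadius k 0 v = 1 := by
  simp [termRadius, radius_zero]

omit [Fintype V] [DecidableEq V] in
theorem termRadius_one (k : ℕ) (v : V) : p.termRadius k 1 v = 1 := by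
  simp [termRadius, radius_one]

theorem term_zero (k : ℕ) (v : V) : p.term k 0 v =
    if p.time v < k then xyObs v (p.angle v) else stabProd p.graph (p.g v) := by
  rw [term]
  split_ifs
  · rfl
  · rw [Complex.ofReal_zero, sub_zero, Complex.ofReal_one]
    module
  · rfl

theorem term_one (k : ℕ) (v : V) : p.term k 1 v = p.term (k + 1) 0 v := by
  rw [term_zero, term]
  rcases lt_trichotomy (p.time v) k with h | h | h
  · simp [h, h.trans k.lt_succ_self]
  · rw [if_neg h.not_lt, if_pos h, if_pos (h ▸ k.lt_succ_self), Complex.ofReal_one, sub_self,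
      Complex.ofReal_zero]
    module
  · simp [h.not_gt, h.ne', Nat.not_lt.2 (Nat.succ_le_of_lt h)]

theorem isSelfAdjoint_term (k : ℕ) (s : ℝ) (v : V) : IsSelfAdjoint (p.term k s v) := by
  rw [term]
  split_ifs
  · exact isSelfAdjoint_xyObs _ _
  · exact (isSelfAdjoint_ofReal_smul (isSelfAdjoint_stabProd _ _) _).add
      (isSelfAdjoint_ofReal_smul (isSelfAdjoint_xyObs _ _) _)
  · exact isSelfAdjoint_stabProd _ _

theorem isSelfAdjoint_hamiltonian (γ : ℝ) (k : ℕ) (s : ℝ) :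
    IsSelfAdjoint (p.hamiltonian γ k s) := by
  rw [hamiltonian_eq]
  exact isSelfAdjoint_neg_smul_sum γ _ (p.isSelfAdjoint_term k s)

theorem continuous_hamiltonian (γ : ℝ) (k : ℕ) : Continuous (p.hamiltonian γ k) := by
  rw [funext (p.hamiltonian_eq γ k)]
  refine Continuous.const_smul (continuous_finsetSum _ fun v _ => ?_) (-γ : ℂ)
  unfold term
  split_ifs
  · exact continuous_const
  · exact ((Complex.continuous_ofReal.comp (continuous_const.sub continuous_id)).smul
      continuous_const).add (Complex.continuous_ofReal.smul continuous_const)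
  · exact continuous_const

theorem hamiltonian_one (γ : ℝ) (k : ℕ) : p.hamiltonian γ k 1 = p.hamiltonian γ (k + 1) 0 := by
  rw [hamiltonian_eq, hamiltonian_eq]
  simp only [term_one]

variable {p}

section Relations

variable (hp : p.IsGflow)
include hp

theorem IsGflow.notMem_g {u v : V} (hu : u ∉ p.output) (h : p.time v ≤ p.time u) :
    v ∉ p.g u := fun hm => (hp.future u hu v hm).not_ge h

/-- (G1) keeps `v` out of `g u` and (G2) makes the connection even. These two facts give every
commutation between different vertices used below. -/
theorem IsGflow.commute {u v : V} (hu : u ∉ p.output) (hne : v ≠ u) (h : p.time v ≤ p.time u)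
    (θ : ℝ) : Commute (stabProd p.graph (p.g u)) (xyObs v θ) :=
  stabProd_commute_xyObs _ (hp.notMem_g hu h) (hp.even u hu v h hne) θ

theorem IsGflow.anticommute {v : V} (hv : v ∉ p.output) (θ : ℝ) :
    stabProd p.graph (p.g v) * xyObs v θ = -(xyObs v θ * stabProd p.graph (p.g v)) :=
  stabProd_anticommute_xyObs _ (hp.notMem_self v hv) (hp.odd_self v hv) θ

/-- Within the current round the cross terms cancel by anticommutation, leaving `(1 - s)² + s²`. -/
theorem IsGflow.term_mul_self {v : V} (hv : v ∉ p.output) (k : ℕ) (s : ℝ) :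
    p.term k s v * p.term k s v = ((p.termRadius k s v ^ 2 : ℝ) : ℂ) • 1 := by
  rw [term, termRadius]
  split_ifs with h1 h2 h2
  · exact absurd h2 h1.ne
  · simp [xyObs_mul_self]
  · rw [radius_sq]
    simp only [mul_add, add_mul, smul_mul_assoc, mul_smul_comm, xyObs_mul_self, stabProd_mul_self,
      hp.anticommute hv]
    push_cast
    module
  · simp [stabProd_mul_self]

/-- During step `k`, a term commutes with both observables of any other vertex of round `k`. -/
theorem IsGflow.term_commute_layer {u v : V} (hu : u ∉ p.output) (hv : v ∉ p.output) (hne : v ≠ u)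
    {k : ℕ} (hk : p.time u = k) (s : ℝ) :
    Commute (p.term k s v) (stabProd p.graph (p.g u)) ∧
      Commute (p.term k s v) (xyObs u (p.angle u)) := by
  have hB : p.time v ≤ k → Commute (xyObs v (p.angle v)) (stabProd p.graph (p.g u)) := fun h =>
    (hp.commute hu hne (h.trans_eq hk.symm) _).symm
  have hA : k ≤ p.time v → Commute (stabProd p.graph (p.g v)) (xyObs u (p.angle u)) := fun h =>
    hp.commute hv hne.symm (hk.trans_le h) _
  have hAA := stabProd_commute p.graph (p.g v) (p.g u)
  have hBB := xyObs_commute (u := v) (v := u) p.angle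
  rw [term]
  split_ifs with h1 h2
  · exact ⟨hB h1.le, hBB⟩
  · exact ⟨(hAA.smul_left _).add_left ((hB h2.le).smul_left _),
      ((hA h2.ge).smul_left _).add_left (hBB.smul_left _)⟩
  · exact ⟨hAA, hA (not_lt.1 h1)⟩

/-- If `u` is not later than `v`, then both possible ingredients of the term of `u` commute with
`K_{g(v)}`. The observable of `v` occurs only when `v` is in the current round or an earlier one,
and then so is `u`. -/
theorem IsGflow.term_commute {u v : V} (hu : u ∉ p.output) (hv : v ∉ p.output) (k : ℕ) (s : ℝ) :
    Commute (p.term k s u) (p.term k s v) := by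
  wlog h : p.time u ≤ p.time v generalizing u v
  · exact (this hv hu (le_of_not_ge h)).symm
  rcases eq_or_ne u v with rfl | hne
  · exact Commute.refl _
  have key : Commute (p.term k s u) (stabProd p.graph (p.g v)) := by
    have hB := (hp.commute hv hne h (p.angle u)).symm
    have hA := stabProd_commute p.graph (p.g u) (p.g v)
    rw [term]
    split_ifs
    · exact hB
    · exact (hA.smul_left _).add_left (hB.smul_left _)
    · exact hA
  rcases lt_trichotomy (p.time v) k with h1 | h1 | h1
  · rw [term, if_pos (h.trans_lt h1), term, if_pos h1]
    exact xyObs_commute p.angle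
  · have h2 := (hp.term_commute_layer hv hu hne h1 s).2
    conv_rhs => rw [term, if_neg h1.not_lt, if_pos h1]
    exact (key.smul_right _).add_right (h2.smul_right _)
  · conv_rhs => rw [term, if_neg h1.not_gt, if_neg h1.ne']
    exact key

end Relations

variable (p)

/-- The joint eigenspace of the terms of the Hamiltonian for their positive eigenvalues. -/
noncomputable def lowSpace (k : ℕ) (s : ℝ) : Submodule ℂ (Qubits V) :=
  jointSpace p.outputᶜ (p.term k s) (p.termRadius k s)

theorem mem_lowSpace {k : ℕ} {s : ℝ} {ψ : Qubits V} :
    ψ ∈ p.lowSpace k s ↔ ∀ v ∉ p.output, p.term k s v ψ = (p.termRadius k s v : ℂ) • ψ := by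
  rw [lowSpace, mem_jointSpace]
  simp

theorem mem_lowSpace_zero {k : ℕ} {ψ : Qubits V} :
    ψ ∈ p.lowSpace k 0 ↔ ∀ v ∉ p.output, p.term k 0 v ψ = ψ := by
  simp [mem_lowSpace, termRadius_zero]

theorem lowSpace_one (k : ℕ) : p.lowSpace k 1 = p.lowSpace (k + 1) 0 := by
  ext ψ
  simp [mem_lowSpace, termRadius_zero, termRadius_one, term_one]

/-- The vertices measured in round `k`. -/
def layer (k : ℕ) : Finset V := p.outputᶜ.filter fun v => p.time v = k

/-- The generator of the parallel transport of step `k`. -/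
noncomputable def generator (k : ℕ) : Op V :=
  ∑ v ∈ p.layer k, xyObs v (p.angle v) * stabProd p.graph (p.g v)

/-- `W` is the parallel transport of step `k`. -/
structure IsTransport (k : ℕ) (W : ℝ → Op V) : Prop where
  zero : W 0 = 1
  hasDerivAt : ∀ χ s, HasDerivAt (fun s => W s χ)
    (((1 / (2 * radius s ^ 2) : ℝ) : ℂ) • p.generator k (W s χ)) s
  bound : ∀ q : ℝ → ℝ, ContDiff ℝ 1 q → ∃ M : ℝ, ∀ χ, ∃ η' : ℝ → Qubits V,
    ∀ s ∈ Icc (0 : ℝ) 1,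
      HasDerivWithinAt (fun s => (q s : ℂ) • p.generator k (W s χ)) (η' s) (Icc 0 1) s ∧
      ‖(q s : ℂ) • p.generator k (W s χ)‖ ≤ M * ‖χ‖ ∧ ‖η' s‖ ≤ M * ‖χ‖
  unitary : ∀ s, W s ∈ unitary (Op V)
  intertwine : ∀ v ∉ p.output, ∀ s,
    p.term k s v * W s = (p.termRadius k s v : ℂ) • (W s * p.term k 0 v)
  readout : ∀ χ ∈ p.lowSpace k 0, ContinuousLinearMap.adjoint p.readout (W 1 χ)
    = (Real.sqrt 2 : ℂ) ^ (p.layer k).card • ContinuousLinearMap.adjoint p.readout χ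

variable {p}

theorem mem_layer {k : ℕ} {v : V} : v ∈ p.layer k ↔ v ∉ p.output ∧ p.time v = k := by
  simp [layer]

theorem adjoint_readout_comp_xyObs {v : V} (hv : v ∉ p.output) :
    ContinuousLinearMap.adjoint p.readout ∘L xyObs v (p.angle v)
      = ContinuousLinearMap.adjoint p.readout := by
  have h : xyObs v (p.angle v) ∘L p.readout = p.readout :=
    ContinuousLinearMap.ext fun χ => xyObs_readout hv χ
  have h2 := congrArg (fun A => ContinuousLinearMap.adjoint A) h
  simp only [ContinuousLinearMap.adjoint_comp] at h2
  rwa [← ContinuousLinearMap.star_eq_adjoint (xyObs v (p.angle v)),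
    (isSelfAdjoint_xyObs _ _).star_eq] at h2

theorem IsGflow.exists_isTransport (hp : p.IsGflow) (k : ℕ) : ∃ W, p.IsTransport k W := by
  have hm : ∀ {v}, v ∈ p.layer k → v ∉ p.output ∧ p.time v = k := fun h => mem_layer.1 h
  obtain ⟨W, h0, hd, hb, hu, hc, hi, hr⟩ := exists_transport_interpolation (p.layer k)
    (fun v => stabProd p.graph (p.g v)) (fun v => xyObs v (p.angle v))
    (fun v _ => isSelfAdjoint_stabProd _ _) (fun v _ => isSelfAdjoint_xyObs _ _)
    (fun v _ => stabProd_mul_self _ _) (fun v _ => xyObs_mul_self _ _)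
    (fun v hv => hp.anticommute (hm hv).1 _) (fun u _ v _ => stabProd_commute _ _ _)
    (fun u _ v _ => xyObs_commute p.angle)
    (fun u hu v hv hne => hp.commute (hm hu).1 hne.symm ((hm hv).2.trans (hm hu).2.symm).le _)
  refine ⟨W, h0, hd, hb, hu, fun v hv s => ?_, fun χ hχ => ?_⟩
  -- Terms of the current round are rotated; all others are constant and commute with the transport.
  · by_cases hk : p.time v = k
    · have := hi v (mem_layer.2 ⟨hv, hk⟩) s
      rw [term_zero, term, termRadius, if_neg hk.not_lt, if_pos hk, if_pos hk, if_neg hk.not_lt]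
      exact this
    · have h1 : p.term k s v = p.term k 0 v := by simp [term, hk]
      have := hc (p.term k s v) (fun u hu => hp.term_commute_layer (hm hu).1 hv
        (fun h => hk (h ▸ (hm hu).2)) (hm hu).2 s) s
      rw [termRadius, if_neg hk, Complex.ofReal_one, one_smul, ← h1, this.eq]
  · refine hr _ χ (fun v hv => adjoint_readout_comp_xyObs (hm hv).1) fun v hv => ?_
    have := p.mem_lowSpace_zero.1 hχ v (hm hv).1
    rwa [term_zero, if_neg (hm hv).2.not_lt] at this

end Pattern

/-! ### Ground spaces, holonomy and adiabatic limit of the computation. -/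

namespace Pattern

open Set

variable {V : Type*} [Fintype V] [DecidableEq V] {p : Pattern V}

theorem IsTransport.norm_apply {k : ℕ} {W : ℝ → Op V} (hW : p.IsTransport k W) (s : ℝ)
    (χ : Qubits V) : ‖W s χ‖ = ‖χ‖ := by
  have h := Unitary.star_mul_self_of_mem (hW.unitary s)
  rw [ContinuousLinearMap.star_eq_adjoint] at h
  exact (ContinuousLinearMap.norm_map_iff_adjoint_comp_self (W s)).2 h χ

theorem IsTransport.apply_mem {k : ℕ} {W : ℝ → Op V} (hW : p.IsTransport k W) (s : ℝ)
    {χ : Qubits V} (hχ : χ ∈ p.lowSpace k 0) : W s χ ∈ p.lowSpace k s := by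
  rw [mem_lowSpace]
  intro v hv
  rw [← mul_apply_eq_comp, hW.intertwine v hv, smul_apply, mul_apply_eq_comp,
    p.mem_lowSpace_zero.1 hχ v hv]

theorem IsTransport.map_lowSpace {k : ℕ} {W : ℝ → Op V} (hW : p.IsTransport k W) (s : ℝ) :
    (p.lowSpace k 0).map (W s : Qubits V →ₗ[ℂ] Qubits V) = p.lowSpace k s := by
  refine le_antisymm ?_ fun ψ hψ => ?_
  · rintro _ ⟨χ, hχ, rfl⟩
    exact hW.apply_mem s hχ
  · have h1 : W s (star (W s) ψ) = ψ := by
      rw [← mul_apply_eq_comp, Unitary.mul_star_self_of_mem (hW.unitary s)]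
      rfl
    refine ⟨star (W s) ψ, p.mem_lowSpace_zero.2 fun v hv => ?_, h1⟩
    have h2 : p.term k s v (W s (star (W s) ψ))
        = (p.termRadius k s v : ℂ) • W s (p.term k 0 v (star (W s) ψ)) :=
      DFunLike.congr_fun (hW.intertwine v hv s) (star (W s) ψ)
    rw [h1, p.mem_lowSpace.1 hψ v hv] at h2
    have h3 : (p.termRadius k s v : ℂ) ≠ 0 := by exact_mod_cast (p.termRadius_pos k s v).ne'
    have h4 := smul_right_injective _ h3 h2
    have h5 := congrArg (fun x => star (W s) x) h4
    beta_reduce at h5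
    rw [← mul_apply_eq_comp (star (W s)), Unitary.star_mul_self_of_mem (hW.unitary s)] at h5
    exact h5.symm

theorem time_lt_depth {v : V} (hv : v ∉ p.output) : p.time v < p.depth :=
  Finset.le_sup (f := fun v => p.time v + 1) (Finset.mem_compl.2 hv)

theorem lowSpace_depth : p.lowSpace p.depth 0 = LinearMap.range 
    (p.readout : Qubits p.output →ₗ[ℂ] Qubits V) := by
  ext ψ
  rw [mem_lowSpace_zero]
  have h : ∀ v ∉ p.output, p.term p.depth 0 v = xyObs v (p.angle v) := fun v hv => by
    rw [term, if_pos (time_lt_depth hv)]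
  constructor
  · intro hψ
    exact exists_readout_eq fun v hv => by rw [← h v hv, hψ v hv]
  · rintro ⟨χ, rfl⟩ v hv
    rw [h v hv]
    exact xyObs_readout hv χ

/-- Unitary transport makes the dimension the same at all times of all steps. It is read off at the
end, where the space is the range of the readout map. -/
theorem finrank_lowSpace (hp : p.IsGflow) (k : ℕ) (s : ℝ) :
    Module.finrank ℂ (p.lowSpace k s) = 2 ^ p.output.card := by
  have h1 : ∀ k s, Module.finrank ℂ (p.lowSpace k s) = Module.finrank ℂ (p.lowSpace k 0) := by
    intro k s
    obtain ⟨W, hW⟩ := hp.exists_isTransport k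
    have hinj : Function.Injective (W s : Qubits V →ₗ[ℂ] Qubits V) :=
      (AddMonoidHomClass.isometry_of_norm (W s) (hW.norm_apply s)).injective
    rw [← hW.map_lowSpace s]
    exact (Submodule.equivMapOfInjective _ hinj _).finrank_eq.symm
  have h2 : ∀ k, Module.finrank ℂ (p.lowSpace k 0) = Module.finrank ℂ (p.lowSpace 0 0) := by
    intro k
    induction k with
    | zero => rfl
    | succ k ih => rw [← lowSpace_one, h1, ih]
  rw [h1, h2, ← h2 p.depth, lowSpace_depth]
  have hinj : Function.Injective (p.readout : Qubits p.output →ₗ[ℂ] Qubits V) :=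
    (AddMonoidHomClass.isometry_of_norm p.readout norm_readout).injective
  rw [LinearMap.finrank_range_of_inj hinj, finrank_euclideanSpace]
  simp

section Spectrum

variable (hp : p.IsGflow) {γ : ℝ} (hγ : 0 < γ) (k : ℕ) (s : ℝ)
include hp hγ

theorem IsGflow.groundEnergy_hamiltonian :
    groundEnergy (p.hamiltonian γ k s) = -γ * ∑ v ∈ p.outputᶜ, p.termRadius k s v := by
  have hm : ∀ {v}, v ∈ p.outputᶜ → v ∉ p.output := Finset.mem_compl.1
  rw [hamiltonian_eq]
  refine groundEnergy_eq _ _ _ (fun v _ => p.isSelfAdjoint_term k s v)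
    (fun v _ => p.termRadius_pos k s v) (fun v hv => hp.term_mul_self (hm hv) k s)
    (fun u hu v hv => hp.term_commute (hm hu) (hm hv) k s) hγ fun h => ?_
  have := finrank_lowSpace hp k s
  rw [lowSpace, h, finrank_bot] at this
  exact (pow_pos two_pos _).ne this

theorem IsGflow.groundSpace_hamiltonian : groundSpace (p.hamiltonian γ k s) = p.lowSpace k s := by
  have hm : ∀ {v}, v ∈ p.outputᶜ → v ∉ p.output := Finset.mem_compl.1
  rw [hamiltonian_eq]
  refine groundSpace_eq _ _ _ (fun v _ => p.isSelfAdjoint_term k s v)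
    (fun v _ => p.termRadius_pos k s v) (fun v hv => hp.term_mul_self (hm hv) k s)
    (fun u hu v hv => hp.term_commute (hm hu) (hm hv) k s) hγ fun h => ?_
  have := finrank_lowSpace hp k s
  rw [lowSpace, h, finrank_bot] at this
  exact (pow_pos two_pos _).ne this

theorem IsGflow.gap {e : ℝ} (he : IsEnergy (p.hamiltonian γ k s) e)
    (hne : e ≠ groundEnergy (p.hamiltonian γ k s)) :
    groundEnergy (p.hamiltonian γ k s) + Real.sqrt 2 * γ ≤ e := by
  have hm : ∀ {v}, v ∈ p.outputᶜ → v ∉ p.output := Finset.mem_compl.1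
  rw [hp.groundEnergy_hamiltonian hγ] at hne ⊢
  rw [hamiltonian_eq] at he
  rcases isEnergy_dichotomy _ _ _ (fun v _ => p.isSelfAdjoint_term k s v)
    (fun v _ => p.termRadius_pos k s v) (fun v hv => hp.term_mul_self (hm hv) k s)
    (fun u hu v hv => hp.term_commute (hm hu) (hm hv) k s) hγ he with h | ⟨v, _, h⟩
  · exact absurd h hne
  · have := mul_le_mul_of_nonneg_right (p.sqrt_two_le_termRadius k s v) hγ.le
    linarith

end Spectrum

/-! ### One step of the computation -/

/-- The summands of the generator map the low space to excited eigenvectors. -/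
theorem IsGflow.term_excitation (hp : p.IsGflow) {k : ℕ} {s : ℝ} {u v : V} (hu : u ∈ p.layer k)
    (hv : v ∉ p.output) {ω : Qubits V} (hω : ω ∈ p.lowSpace k s) :
    p.term k s v ((xyObs u (p.angle u) * stabProd p.graph (p.g u)) ω)
      = ((if v = u then -radius s else p.termRadius k s v : ℝ) : ℂ) •
        (xyObs u (p.angle u) * stabProd p.graph (p.g u)) ω := by
  obtain ⟨hu, huk⟩ := mem_layer.1 hu
  have hv' := p.mem_lowSpace.1 hω v hv
  by_cases h : v = u
  · subst h
    have hanti := hp.anticommute hv (p.angle v)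
    have h1 : p.term k s v * (xyObs v (p.angle v) * stabProd p.graph (p.g v))
        = -((xyObs v (p.angle v) * stabProd p.graph (p.g v)) * p.term k s v) := by
      rw [term, if_neg huk.not_lt, if_pos huk]
      exact combination_mul_of_anticommute hanti _ _
    rw [← mul_apply_eq_comp, h1, neg_apply, mul_apply_eq_comp, hv', if_pos rfl, termRadius,
      if_pos huk, map_smul]
    push_cast
    module
  · have hc := hp.term_commute_layer hu hv h huk s
    have := (hc.2.mul_right hc.1).eq
    rw [← mul_apply_eq_comp, this, mul_apply_eq_comp, hv', map_smul, if_neg h]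

/-- Each summand of the generator sends `ω` to the eigenvalue `-r` of a self-adjoint term that
equals `r` on the whole low space. -/
theorem IsGflow.generator_mem_orthogonal (hp : p.IsGflow) {k : ℕ} {s : ℝ} {ω : Qubits V}
    (hω : ω ∈ p.lowSpace k s) : p.generator k ω ∈ (p.lowSpace k s)ᗮ := by
  rw [generator, sum_apply]
  refine Submodule.sum_mem _ fun u hu => (Submodule.mem_orthogonal _ _).2 fun ξ hξ => ?_
  obtain ⟨huo, huk⟩ := mem_layer.1 hu
  have h1 := hp.term_excitation hu huo hω
  have h2 := p.mem_lowSpace.1 hξ u huo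
  set ζ := (xyObs u (p.angle u) * stabProd p.graph (p.g u)) ω
  have h3 : inner ℂ (p.term k s u ξ) ζ = inner ℂ ξ (p.term k s u ζ) := by
    rw [← ContinuousLinearMap.adjoint_inner_right, ← ContinuousLinearMap.star_eq_adjoint,
      (p.isSelfAdjoint_term k s u).star_eq]
  rw [h1, h2, if_pos rfl, termRadius, if_pos huk, inner_smul_left, inner_smul_right,
    Complex.conj_ofReal] at h3
  have h4 : (radius s : ℂ) ≠ 0 := by exact_mod_cast (radius_pos s).ne'
  have h5 : (2 * radius s : ℂ) * inner ℂ ξ ζ = 0 := by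
    push_cast at h3
    linear_combination h3
  simpa [h4] using h5

/-- Each summand flips exactly one term of the current round, and all these terms have the same
radius. The image of the generator therefore has a single energy, `2γr` above the ground energy. -/
theorem IsGflow.hamiltonian_generator (hp : p.IsGflow) (γ : ℝ) {k : ℕ} {s : ℝ} {ω : Qubits V}
    (hω : ω ∈ p.lowSpace k s) : p.hamiltonian γ k s (p.generator k ω)
      = ((-γ * ∑ v ∈ p.outputᶜ, p.termRadius k s v + 2 * γ * radius s : ℝ) : ℂ) •
        p.generator k ω := by
  rw [generator, sum_apply, map_sum, Finset.smul_sum]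
  refine Finset.sum_congr rfl fun u hu => ?_
  obtain ⟨huo, huk⟩ := mem_layer.1 hu
  have h : ∑ v ∈ p.outputᶜ, (if v = u then -radius s else p.termRadius k s v)
      = ∑ v ∈ p.outputᶜ, p.termRadius k s v - 2 * radius s := by
    have h0 : ∀ v ∈ p.outputᶜ, (if v = u then -radius s else p.termRadius k s v)
        = p.termRadius k s v - if v = u then 2 * radius s else 0 := fun v _ => by
      split_ifs with h
      · subst h
        rw [termRadius, if_pos huk]
        ring
      · ring
    rw [Finset.sum_congr rfl h0, Finset.sum_sub_distrib, Finset.sum_ite_eq',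
      if_pos (Finset.mem_compl.2 huo)]
  rw [hamiltonian_eq, smul_apply, sum_apply,
    Finset.sum_congr rfl fun v hv => hp.term_excitation hu (Finset.mem_compl.1 hv) hω,
    ← Finset.sum_smul, ← Complex.ofReal_sum, h, smul_smul]
  congr 1
  push_cast
  ring

theorem IsGflow.isParallel (hp : p.IsGflow) {γ : ℝ} (hγ : 0 < γ) {k : ℕ} {W : ℝ → Op V}
    (hW : p.IsTransport k W) {χ : Qubits V} (hχ : χ ∈ p.lowSpace k 0) :
    IsParallel (p.hamiltonian γ k) fun s => W s χ := by
  intro s _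
  rw [hp.groundSpace_hamiltonian hγ]
  exact ⟨hW.apply_mem s hχ, _, Submodule.smul_mem _ _ (hp.generator_mem_orthogonal (hW.apply_mem s hχ)),
    (hW.hasDerivAt χ s).hasDerivWithinAt⟩

theorem IsGflow.exists_adiabatic_bound (hp : p.IsGflow) {γ : ℝ} (hγ : 0 < γ) {k : ℕ} {W : ℝ → Op V}
    (hW : p.IsTransport k W) : ∃ C : ℝ, ∀ τ > 0, ∀ c : ℂ, ‖c‖ = 1 → ∃ c' : ℂ, ‖c'‖ = 1 ∧
      ∀ χ ∈ p.lowSpace k 0, ‖χ‖ = 1 → ∀ ψ, IsSchrodinger (p.hamiltonian γ k) τ ψ →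
        ‖ψ 1 - c' • W 1 χ‖ ≤ ‖ψ 0 - c • χ‖ + C / τ := by
  -- The factor solves `(H - e) η = ω'`: the velocity has coefficient `1 / (2r²)`, which is divided
  -- by the gap `2γr`.
  obtain ⟨M, hM⟩ := hW.bound (fun s => 1 / (4 * γ * radius s ^ 3))
    (contDiff_const.div (contDiff_const.mul (contDiff_radius.pow 3))
      fun s => by have := radius_pos s; positivity)
  set e : ℝ → ℝ := fun s => -γ * ∑ v ∈ p.outputᶜ, p.termRadius k s v with he
  have hec : Continuous e := by
    refine continuous_const.mul (continuous_finsetSum _ fun v _ => ?_)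
    unfold termRadius
    split_ifs
    · exact (contDiff_radius (n := 0)).continuous
    · exact continuous_const
  set F : ℝ → ℝ := fun s => ∫ x in (0 : ℝ)..s, e x
  have hF : ∀ s, HasDerivAt F (e s) s := fun s =>
    intervalIntegral.integral_hasDerivAt_right (hec.intervalIntegrable 0 s)
      hec.aestronglyMeasurable.stronglyMeasurableAtFilter hec.continuousAt
  -- The new phase is the dynamical one, given by the integral of the ground energy; it is chosen
  -- before `χ`.
  refine ⟨3 * M, fun τ hτ c hc => ⟨c * Complex.exp (-(Complex.I * τ) * (F 1 - F 0 : ℝ)), ?_,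
    fun χ hχ hχ1 ψ hψ => ?_⟩⟩
  · rw [norm_mul, hc, one_mul, show -(Complex.I * τ) * ((F 1 - F 0 : ℝ) : ℂ)
      = ((-τ * (F 1 - F 0) : ℝ) : ℂ) * Complex.I by push_cast; ring, Complex.norm_exp_ofReal_mul_I]
  · obtain ⟨η', hη⟩ := hM χ
    have hmem : ∀ s, W s χ ∈ p.lowSpace k s := fun s => hW.apply_mem s hχ
    have key := adiabatic_estimate (H := p.hamiltonian γ k) (e := e) (F := F) (ψ := ψ)
      (ω := fun s => W s χ) (M := M)
      (η := fun s => ((1 / (4 * γ * radius s ^ 3) : ℝ) : ℂ) • p.generator k (W s χ)) (η' := η')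
      (fun s _ => p.isSelfAdjoint_hamiltonian γ k s) (fun s _ => (hF s).hasDerivWithinAt)
      (fun s _ => ?_) (fun s _ => ?_) (fun s hs => (hη s hs).1)
      (fun s hs => by simpa [hχ1] using (hη s hs).2) hτ hψ hc
    · rwa [hW.zero, one_apply_eq_self] at key
    · refine (hW.hasDerivAt χ s).hasDerivWithinAt.congr_deriv ?_
      rw [map_smul, hp.hamiltonian_generator γ (hmem s), smul_smul, smul_smul, ← sub_smul,
        ← Complex.ofReal_mul, ← Complex.ofReal_mul, ← Complex.ofReal_sub]
      congr 2
      have := (radius_pos s).ne'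
      rw [he]
      field_simp
      ring
    · rw [hamiltonian_eq]
      exact sum_apply_of_mem_jointSpace (hmem s) γ

/-! ### The whole computation -/

/-- The composition of the parallel transports of the first `k` steps, applied to encoded states. -/
noncomputable def logical (W : ℕ → ℝ → Op V) : ℕ → Qubits p.input →L[ℂ] Qubits V
  | 0 => p.encode
  | k + 1 => W k 1 ∘L logical W k

section Computation

variable (hp : p.IsGflow) {W : ℕ → ℝ → Op V} (hW : ∀ k, p.IsTransport k (W k))

include hp in
theorem IsGflow.encode_mem (φ : Qubits p.input) : p.encode φ ∈ p.lowSpace 0 0 := by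
  refine p.mem_lowSpace_zero.2 fun v hv => ?_
  rw [term_zero, if_neg (Nat.not_lt_zero _)]
  exact stabProd_encode (hp.notMem_input v hv) φ

include hW

theorem norm_logical (k : ℕ) (φ : Qubits p.input) : ‖logical W k φ‖ = ‖φ‖ := by
  induction k with
  | zero => exact norm_encode φ
  | succ k ih => rw [logical, ContinuousLinearMap.comp_apply, (hW k).norm_apply, ih]

include hp

theorem IsGflow.logical_mem (k : ℕ) (φ : Qubits p.input) : logical W k φ ∈ p.lowSpace k 0 := by
  induction k with
  | zero => exact hp.encode_mem φ
  | succ k ih =>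
    rw [← lowSpace_one]
    exact (hW k).apply_mem 1 ih

/-- Every vertex already treated contributes a factor `√2`, so the holonomy is a renormalised
projection of the encoded state. -/
theorem IsGflow.adjoint_readout_logical (k : ℕ) (φ : Qubits p.input) :
    ContinuousLinearMap.adjoint p.readout (logical W k φ)
      = (Real.sqrt 2 : ℂ) ^ (p.outputᶜ.filter fun v => p.time v < k).card •
        ContinuousLinearMap.adjoint p.readout (p.encode φ) := by
  induction k with
  | zero => simp [logical]
  | succ k ih =>
    have h : (p.outputᶜ.filter fun v => p.time v < k + 1).card
        = (p.layer k).card + (p.outputᶜ.filter fun v => p.time v < k).card := by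
      rw [layer, ← Finset.card_union_of_disjoint, ← Finset.filter_or]
      · congr 1
        refine Finset.filter_congr fun v _ => ?_
        omega
      · exact Finset.disjoint_filter.2 fun v _ h => h.not_lt
    rw [logical, ContinuousLinearMap.comp_apply, (hW k).readout _ (hp.logical_mem hW k φ), ih,
      smul_smul, ← pow_add, h]

theorem IsGflow.readout_adjoint_logical (φ : Qubits p.input) :
    p.readout (ContinuousLinearMap.adjoint p.readout (logical W p.depth φ))
      = logical W p.depth φ := by
  have h := hp.logical_mem hW p.depth φ
  rw [lowSpace_depth] at h
  obtain ⟨χ, hχ⟩ := h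
  rw [← hχ]
  exact congrArg p.readout (adjoint_readout_readout χ)

theorem IsGflow.holonomyMaps_iff {γ : ℝ} (hγ : 0 < γ) (d : ℕ) (φ : Qubits p.input) (b : Qubits V) :
    HolonomyMaps (p.hamiltonian γ) d (p.encode φ) b ↔ b = logical W d φ := by
  constructor
  · rintro ⟨χ, h0, rfl, h⟩
    -- By uniqueness of parallel transport, any admissible chain of states agrees with that of the
    -- transports `W`.
    have : ∀ k ≤ d, χ k = logical W k φ := by
      intro k
      induction k with
      | zero => exact fun _ => h0
      | succ k ih =>
        intro hk
        obtain ⟨ψ, hψ, hψ0, hψ1⟩ := h k hk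
        rw [← hψ1]
        refine hψ.unique (hp.isParallel hγ (hW k) (hp.logical_mem hW k φ)) ?_
        rw [hψ0, ih (Nat.le_of_succ_le hk), (hW k).zero]
        rfl
    exact this d le_rfl
  · rintro rfl
    refine ⟨fun k => logical W k φ, rfl, rfl, fun k _ => ⟨fun s => W k s (logical W k φ),
      hp.isParallel hγ (hW k) (hp.logical_mem hW k φ), ?_, rfl⟩⟩
    beta_reduce
    rw [(hW k).zero]
    rfl

theorem IsGflow.exists_evolution_bound {γ : ℝ} (hγ : 0 < γ) (d : ℕ) :
    ∃ C : ℝ, ∀ τ > 0, ∃ c : ℂ, ‖c‖ = 1 ∧ ∀ φ, ‖φ‖ = 1 → ∀ b,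
      EvolutionMaps (p.hamiltonian γ) d τ (p.encode φ) b → ‖b - c • logical W d φ‖ ≤ C / τ := by
  induction d with
  | zero =>
    refine ⟨0, fun τ _ => ⟨1, norm_one, fun φ _ b => ?_⟩⟩
    rintro ⟨χ, h0, rfl, -⟩
    simp [h0, logical]
  | succ d ih =>
    obtain ⟨C, hC⟩ := ih
    obtain ⟨C', hC'⟩ := hp.exists_adiabatic_bound hγ (hW d)
    refine ⟨C + C', fun τ hτ => ?_⟩
    obtain ⟨c, hc, hb⟩ := hC τ hτ
    obtain ⟨c', hc', hb'⟩ := hC' τ hτ c hc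
    refine ⟨c', hc', fun φ hφ b => ?_⟩
    rintro ⟨χ, h0, rfl, h⟩
    obtain ⟨ψ, hψ, hψ0, hψ1⟩ := h d d.lt_succ_self
    have h1 := hb φ hφ (χ d) ⟨χ, h0, rfl, fun k hk => h k (hk.trans d.lt_succ_self)⟩
    have h2 := hb' _ (hp.logical_mem hW d φ) ((norm_logical hW d φ).trans hφ) ψ hψ
    rw [hψ0, hψ1] at h2
    rw [add_div]
    exact h2.trans (by gcongr)

end Computation

theorem exists_evolutionMaps {H : ℕ → ℝ → Op V} (hH : ∀ k, Continuous (H k)) (d : ℕ) (τ : ℝ)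
    (a : Qubits V) : ∃ b, EvolutionMaps H d τ a b := by
  choose ψ hψ hψ0 using fun (k : ℕ) (x : Qubits V) => exists_isSchrodinger (hH k) τ x
  let χ : ℕ → Qubits V := fun n => Nat.rec a (fun k x => ψ k x 1) n
  exact ⟨χ d, χ, rfl, rfl, fun k _ => ⟨ψ k (χ k), hψ k _, hψ0 k _, rfl⟩⟩

/-- The logical operation of the pattern. -/
theorem IsGflow.exists_isometry (hp : p.IsGflow) {W : ℕ → ℝ → Op V}
    (hW : ∀ k, p.IsTransport k (W k)) :
    ∃ U : Qubits p.input →ₗᵢ[ℂ] Qubits p.output,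
      (∀ φ, p.readout (U φ) = logical W p.depth φ) ∧ p.Implements U := by
  let U : Qubits p.input →ₗᵢ[ℂ] Qubits p.output :=
    { toLinearMap := (ContinuousLinearMap.adjoint p.readout ∘L logical W p.depth :
        Qubits p.input →L[ℂ] Qubits p.output)
      norm_map' := fun φ => by
        rw [← norm_readout]
        exact (congrArg norm (hp.readout_adjoint_logical hW φ)).trans (norm_logical hW _ φ) }
  have hU : ∀ φ, U φ = ContinuousLinearMap.adjoint p.readout (logical W p.depth φ) := fun _ => rfl
  refine ⟨U, fun φ => ?_, fun m => ?_⟩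
  · rw [hU, hp.readout_adjoint_logical hW]
  · obtain ⟨c, hc, h⟩ := exists_phase_branch hp m
    refine ⟨c, hc, fun φ => ?_⟩
    -- After the last step all non-outputs have contributed, and the factors `√2` cancel the
    -- normalisation of the branch.
    have h1 : (p.outputᶜ.filter fun v => p.time v < p.depth) = p.outputᶜ :=
      Finset.filter_true_of_mem fun v hv => time_lt_depth (Finset.mem_compl.1 hv)
    have h2 : (Real.sqrt 2 : ℂ) ≠ 0 := by simp
    rw [hU, hp.adjoint_readout_logical hW, h1, smul_smul, mul_assoc, ← mul_pow,
      inv_mul_cancel₀ h2, one_pow, mul_one]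
    exact h _ fun u hu => stabProd_encode (hp.notMem_input u hu) φ

end Pattern
end AGQC

theorem mainTheorem1 {V : Type*} [Fintype V] [DecidableEq V] (p : AGQC.Pattern V)
    (hp : p.IsGflow) :
    p.IsCausal ∧
    ∃ U : AGQC.Qubits p.input →ₗᵢ[ℂ] AGQC.Qubits p.output,
      p.Implements U ∧
      ∀ γ : ℝ, 0 < γ →
        -- Hermitian, with a ground space of constant degeneracy and a constant energy gap
        (∀ k < p.depth, ∀ s ∈ Set.Icc (0 : ℝ) 1,
          IsSelfAdjoint (p.hamiltonian γ k s) ∧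
          Module.finrank ℂ (AGQC.groundSpace (p.hamiltonian γ k s)) = 2 ^ p.output.card ∧
          ∀ E : ℝ, AGQC.IsEnergy (p.hamiltonian γ k s) E →
            E ≠ AGQC.groundEnergy (p.hamiltonian γ k s) →
            AGQC.groundEnergy (p.hamiltonian γ k s) + Real.sqrt 2 * γ ≤ E) ∧
        -- consecutive steps fit together
        (∀ k, p.hamiltonian γ k 1 = p.hamiltonian γ (k + 1) 0) ∧
        -- the computation starts in the ground space
        (∀ φ, p.encode φ ∈ AGQC.groundSpace (p.hamiltonian γ 0 0)) ∧
        -- the holonomy is the logical operation of the pattern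
        (∀ φ b, AGQC.HolonomyMaps (p.hamiltonian γ) p.depth (p.encode φ) b ↔
          b = p.readout (U φ)) ∧
        -- and it is what slow driving of the system performs
        (∀ ε > (0 : ℝ), ∃ T : ℝ, 0 < T ∧ ∀ τ ≥ T, ∃ c : ℂ, ‖c‖ = 1 ∧
          ∀ φ, ‖φ‖ = 1 →
            (∃ b, AGQC.EvolutionMaps (p.hamiltonian γ) p.depth τ (p.encode φ) b) ∧
            ∀ b, AGQC.EvolutionMaps (p.hamiltonian γ) p.depth τ (p.encode φ) b →
              ‖b - c • p.readout (U φ)‖ ≤ ε) := by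
  choose W hW using hp.exists_isTransport
  obtain ⟨U, hU, hUp⟩ := hp.exists_isometry hW
  refine ⟨hp.isCausal, U, hUp, fun γ hγ => ⟨fun k _ s _ => ⟨p.isSelfAdjoint_hamiltonian γ k s, ?_,
    fun e he hne => hp.gap hγ k s he hne⟩, p.hamiltonian_one γ, fun φ => ?_, fun φ b => ?_,
    fun ε hε => ?_⟩⟩
  · rw [hp.groundSpace_hamiltonian hγ, AGQC.Pattern.finrank_lowSpace hp]
  · rw [hp.groundSpace_hamiltonian hγ]
    exact hp.encode_mem φ
  · rw [hU]
    exact hp.holonomyMaps_iff hW hγ p.depth φ b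
  · obtain ⟨C, hC⟩ := hp.exists_evolution_bound hW hγ p.depth
    -- `C / τ ≤ ε` as soon as `τ ≥ C / ε`; the maximum with 1 keeps `T` positive.
    refine ⟨max 1 (C / ε), lt_max_of_lt_left one_pos, fun τ hτ => ?_⟩
    have hτ0 : 0 < τ := one_pos.trans_le ((le_max_left _ _).trans hτ)
    obtain ⟨c, hc, hb⟩ := hC τ hτ0
    refine ⟨c, hc, fun φ hφ => ⟨AGQC.Pattern.exists_evolutionMaps (p.continuous_hamiltonian γ) _ _ _,
      fun b hEb => ?_⟩⟩
    rw [hU]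
    refine (hb φ hφ b hEb).trans ((div_le_iff₀ hτ0).2 ?_)
    have := (div_le_iff₀ hε).1 ((le_max_right _ _).trans hτ)
    linarith
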